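/- **Setting.** Let $X_t=f_t+\epsilon_t$, $t=1,\dots,T$, where $\epsilon_1,\dots,\epsilon_T$ are i.i.d. $\mathcal N(0,1)$ and $f$ is a deterministic continuous, piecewise-linear signal with $N\ge 0$ change-points $0=r_0<r_1<\dots<r_N<r_{N+1}=T$: for $j=1,\dots,N+1$, $f_t=\mu_{j,1}+\mu_{j,2}t$ for $t=r_{j-1}+1,\dots,r_j$; for $j=1,\dots,N$, $\mu_{j,1}+\mu_{j,2}r_j=\mu_{j+1,1}+\mu_{j+1,2}r_j$ and $f_{r_j-1}+f_{r_j+1}\ne 2f_{r_j}$. Put $\Delta_j^f=|2f_{r_j}-f_{r_j+1}-f_{r_j-1}|$, $\underline f_T=\min_{1\le j\le N}\Delta^f_j$ ($=+\infty$ if $N=0$), $\tilde\delta_j=r_{j+1}-r_j$ and $\delta_T=\min_{0\le j\le N}\tilde\delta_j$. **Algorithm.** For $1\le s\le b<e\le T$ and $\ell=e-s+1$ let $C^b_{s,e}(X)=|\sum_{t=s}^{e}X_t\,\phi^b_{s,e}(t)|$ with $$\phi^b_{s,e}(t)=\begin{cases}\alpha\beta\,[(e+2b-3s+2)t-(be+bs-2s^2+2s)],&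 s\le t\le b,\\ -\frac{\alpha}{\beta}\,[(3e-2b-s+2)t-(2e^2+2e-be-bs)],& b<t\le e,\end{cases}$$ $$\alpha=\Bigl(\tfrac{6}{\ell(\ell^2-1)(1+(e-b+1)(b-s+1)+(e-b)(b-s))}\Bigr)^{1/2},\qquad \beta=\Bigl(\tfrac{(e-b+1)(e-b)}{(b-s+1)(b-s)}\Bigr)^{1/2}$$ (and $\phi^s_{s,e}=0$). Given an expansion parameter $\lambda_T\in\mathbb N$, $\lambda_T\ge1$, and a threshold $\zeta_T$, the procedure DAIS$(s,e)$ stops if $e-s<3$. Otherwise let $d_{s,e}$ be the (smallest) maximiser of $|X_{t+2}-2X_{t+1}+X_t|$ over $t\in\{s,\dots,e-2\}$, let $c^l_m=\max\{d_{s,e}-m\lambda_T,s\}$, $c^r_k=\min\{d_{s,e}+k\lambda_T-1,e\}$, and let $K^{\min}\le K^{\max}$ be the smaller and the larger of $\lceil (d_{s,e}-s+1)/\lambda_T\rceil$ and $\lceil (e-d_{s,e}+1)/\lambda_T\rceil$. It checks, in this order, the intervals $[c^l_{k-1},c^r_k],[c^l_k,c^r_k]$ for $k=1,\dots,K^{\min}$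 and then $[c^l_k,c^r_k]$ for $k=K^{\min}+1,\dots,K^{\max}$. At the first checked interval $[s',e']$ with $\max_{s'\le b<e'}C^b_{s',e'}(X)>\zeta_T$, it adds the (smallest) maximiser $b$ to the list of estimates and runs DAIS$(s,s')$ and DAIS$(e',e)$; if there is no such interval, it stops. Let $\hat N$ be the number of estimates produced by DAIS$(1,T)$ and $\hat r_1,\dots,\hat r_{\hat N}$ these estimates, sorted in increasing order. **Assumptions.** Fix a constant $n\ge 3/2$ and suppose $\lambda_T\le\delta_T/(2n)$. (A1) is the event that, every time DAIS is applied to an interval $[s,e]$ with $e-s\ge3$ which contains at least one change-point, $$d_{s,e}\in\Bigl[1,\,r_1+\tfrac{\tilde\delta_1}{2}-\tfrac{3\delta_T}{4n}\Bigr]\cup\Bigl[r_N-\tfrac{\tilde\delta_{N-1}}{2}+\tfrac{3\delta_T}{4n},\,T-2\Bigr]\cup\bigcup_{j=2}^{N-1}\Bigl[r_j-\tfrac{\tilde\delta_{j-1}}{2}+\tfrac{3\delta_T}{4n},\,r_j+\tfrac{\tilde\delta_j}{2}-\tfrac{3\delta_T}{4n}\Bigr].$$ (A3) $\delta_T^{3/2}\,\underline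 f_T\ge C^*\sqrt{\log T}$. **Theorem.** For every $n\ge3/2$ and every large enough $C^*$ (depending only on $n$) there are positive constants $C_1,C_2,C_3,C_4$ and a $T_0$, depending only on $n$ and $C^*$, such that for all $T\ge T_0$, all signals as above which satisfy (A3), all $\lambda_T$ as above and all $\zeta_T$ with $C_1\sqrt{\log T}\le\zeta_T<C_2\,\delta_T^{3/2}\underline f_T$, up to an event of probability at most $C_4/T$ the assumption (A1) implies $$\hat N=N\quad\text{and}\quad \max_{1\le j\le N}|\hat r_j-r_j|\,(\Delta^f_j)^{2/3}\le C_3(\log T)^{1/3};$$ that is, the event "(A1) fails, or both of these hold" has probability at least $1-C_4/T$. In particular, if (A1) holds almost surely, then the two conclusions hold together with probability at least $1-C_4/T$. -/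

import Mathlib

open MeasureTheory ProbabilityTheory
open scoped ENNReal

noncomputable section

namespace DAIS

/-! ### The signal -/

/-- `f` (observed at the times `1, …, T`) is continuous and piecewise linear with exactly the
`N` change-points `r 1 < ⋯ < r N`, under the conventions `r 0 = 0` and `r (N + 1) = T`. -/
structure IsContPiecewiseLinear (T : ℕ) (f : ℕ → ℝ) (N : ℕ) (r : ℕ → ℕ) : Prop where
  r_zero : r 0 = 0
  r_last : r (N + 1) = T
  r_lt : ∀ j ≤ N, r j < r (j + 1)
  /-- linear pieces which agree at the change-points -/
  pieces : ∃ μ₁ μ₂ : ℕ → ℝ,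
    (∀ j ∈ Finset.Icc 1 (N + 1), ∀ t ∈ Finset.Icc (r (j - 1) + 1) (r j),
      f t = μ₁ j + μ₂ j * (t : ℝ)) ∧
    ∀ j ∈ Finset.Icc 1 N, μ₁ j + μ₂ j * (r j : ℝ) = μ₁ (j + 1) + μ₂ (j + 1) * (r j : ℝ)
  /-- the slope does change at every change-point -/
  change : ∀ j ∈ Finset.Icc 1 N, f (r j - 1) + f (r j + 1) ≠ 2 * f (r j)

/-- The magnitude `Δ_j^f = |2 f_{r_j} - f_{r_j + 1} - f_{r_j - 1}|` of the `j`-th change. -/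
def jump (f : ℕ → ℝ) (r : ℕ → ℕ) (j : ℕ) : ℝ :=
  |2 * f (r j) - f (r j + 1) - f (r j - 1)|

/-- The minimum magnitude of change `min_{1 ≤ j ≤ N} Δ_j^f` (`∞` when there is no change). -/
def minJump (f : ℕ → ℝ) (N : ℕ) (r : ℕ → ℕ) : ℝ≥0∞ :=
  ⨅ j ∈ Finset.Icc 1 N, ENNReal.ofReal (jump f r j)

/-- The distance `r_{j+1} - r_j` of consecutive change-points. -/
def gap (r : ℕ → ℕ) (j : ℕ) : ℕ := r (j + 1) - r j

/-- The minimum distance `δ_T = min_{0 ≤ j ≤ N} (r_{j+1} - r_j)`. -/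
def minGap (N : ℕ) (r : ℕ → ℕ) : ℕ :=
  (Finset.range (N + 1)).inf' Finset.nonempty_range_add_one (gap r)

/-! ### The contrast function -/

/-- The normalisation `α^b_{s,e}`. -/
def phiAlpha (s e b : ℝ) : ℝ :=
  √(6 / ((e - s + 1) * ((e - s + 1) ^ 2 - 1) *
    (1 + (e - b + 1) * (b - s + 1) + (e - b) * (b - s))))

/-- The ratio `β^b_{s,e}`.  For `b = s`, where the formula divides by zero, the value is `0`, and
then the contrast vector `phi` vanishes (a kink at the first point of `[s, e]` is invisible). -/
def phiBeta (s e b : ℝ) : ℝ :=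
  √(((e - b + 1) * (e - b)) / ((b - s + 1) * (b - s)))

/-- The contrast vector `φ^b_{s,e}` for a change in the slope. -/
def phi (s e b t : ℕ) : ℝ :=
  if s ≤ t ∧ t ≤ b then
    phiAlpha s e b * phiBeta s e b *
      (((e : ℝ) + 2 * b - 3 * s + 2) * t - ((b : ℝ) * e + b * s - 2 * s ^ 2 + 2 * s))
  else if b + 1 ≤ t ∧ t ≤ e then
    -(phiAlpha s e b / phiBeta s e b) *
      ((3 * (e : ℝ) - 2 * b - s + 2) * t - (2 * (e : ℝ) ^ 2 + 2 * e - b * e - b * s))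
  else 0

/-- The contrast function `C^b_{s,e}(x) = |⟨x, φ^b_{s,e}⟩|`; the vector `φ^b_{s,e}` is supported
on `{s, …, e}`. -/
def contrast (x : ℕ → ℝ) (s e b : ℕ) : ℝ :=
  |∑ t ∈ Finset.Icc s e, x t * phi s e b t|

/-! ### The algorithm -/

/-- The (first) maximiser of `g` over a finite non-empty set of indices. -/
def argmaxOn (S : Finset ℕ) (g : ℕ → ℝ) : ℕ :=
  sInf {t | t ∈ S ∧ ∀ u ∈ S, g u ≤ g t}

/-- The location `d_{s,e}` of the largest second difference in `[s, e]`. -/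
def largestDiff (x : ℕ → ℝ) (s e : ℕ) : ℕ :=
  argmaxOn (Finset.Icc s (e - 2)) fun t => |x (t + 2) - 2 * x (t + 1) + x t|

/-- Left end-points `c^l_m = max {d - m λ, s}`. -/
def leftPt (lam d s m : ℕ) : ℕ := max (d - m * lam) s

/-- Right end-points `c^r_k = min {d + k λ - 1, e}`. -/
def rightPt (lam d e k : ℕ) : ℕ := min (d + k * lam - 1) e

/-- `K^l = ⌈(d - s + 1) / λ⌉`. -/
def numLeft (lam d s : ℕ) : ℕ := ⌈((d : ℝ) - s + 1) / (lam : ℝ)⌉₊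

/-- `K^r = ⌈(e - d + 1) / λ⌉`. -/
def numRight (lam d e : ℕ) : ℕ := ⌈((e : ℝ) - d + 1) / (lam : ℝ)⌉₊

/-- The right- and left-expanding intervals around `d`, in the order in which they are checked:
`[c^l_0, c^r_1], [c^l_1, c^r_1], [c^l_1, c^r_2], …, [c^l_{Kmin}, c^r_{Kmin}]`, followed by
`[c^l_{Kmin+1}, c^r_{Kmin+1}], …, [c^l_{Kmax}, c^r_{Kmax}]`. -/
def intervals (lam d s e : ℕ) : List (ℕ × ℕ) :=
  let kmin := min (numLeft lam d s) (numRight lam d e)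
  let kmax := max (numLeft lam d s) (numRight lam d e)
  ((List.range kmin).flatMap fun k =>
      [(leftPt lam d s k, rightPt lam d e (k + 1)),
        (leftPt lam d s (k + 1), rightPt lam d e (k + 1))]) ++
    (List.range (kmax - kmin)).map fun i =>
      (leftPt lam d s (kmin + 1 + i), rightPt lam d e (kmin + 1 + i))

/-- The maximiser of the contrast function over `[I.1, I.2)`. -/
def bestSplit (x : ℕ → ℝ) (I : ℕ × ℕ) : ℕ :=
  argmaxOn (Finset.Ico I.1 I.2) (contrast x I.1 I.2)

/-- The maximum of the contrast function over `[I.1, I.2)` exceeds the threshold (a one-point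
interval has no candidate location). -/
def Exceeds (x : ℕ → ℝ) (zeta : ℝ) (I : ℕ × ℕ) : Prop :=
  I.1 < I.2 ∧ zeta < contrast x I.1 I.2 (bestSplit x I)

open scoped Classical in
/-- The first checked interval of `[s, e]` on which the threshold is exceeded, if any. -/
def detection (x : ℕ → ℝ) (lam : ℕ) (zeta : ℝ) (s e : ℕ) : Option (ℕ × ℕ) :=
  (intervals lam (largestDiff x s e) s e).find? fun I => decide (Exceeds x zeta I)

theorem argmaxOn_mem {S : Finset ℕ} (hS : S.Nonempty) (g : ℕ → ℝ) : argmaxOn S g ∈ S := by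
  obtain ⟨t, ht, hmax⟩ := S.exists_max_image g hS
  exact (Nat.sInf_mem (s := {t | t ∈ S ∧ ∀ u ∈ S, g u ≤ g t}) ⟨t, ht, hmax⟩).1

theorem endpoints_of_mem_intervals {lam d s e : ℕ} {I : ℕ × ℕ} (hI : I ∈ intervals lam d s e) :
    (∃ m, I.1 = leftPt lam d s m) ∧ ∃ k, I.2 = rightPt lam d e k := by
  simp only [intervals, List.mem_append, List.mem_flatMap, List.mem_map, List.mem_cons,
    List.not_mem_nil, or_false] at hI
  rcases hI with ⟨k, -, rfl | rfl⟩ | ⟨i, -, rfl⟩ <;> exact ⟨⟨_, rfl⟩, ⟨_, rfl⟩⟩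

/-- The bounds which make the recursion of the algorithm terminate. -/
theorem detection_bounds {x : ℕ → ℝ} {lam : ℕ} {zeta : ℝ} {s e : ℕ} {I : ℕ × ℕ}
    (hI : detection x lam zeta s e = some I) :
    s ≤ I.1 ∧ I.1 < I.2 ∧ I.2 ≤ e ∧ I.1 < e := by
  classical
  have h1 : I.1 < I.2 := by
    have := List.find?_some hI
    simp only [decide_eq_true_eq] at this
    exact this.1
  obtain ⟨⟨m, hm⟩, ⟨k, hk⟩⟩ := endpoints_of_mem_intervals (List.mem_of_find?_eq_some hI)
  have h2 : s ≤ I.1 := by rw [hm]; exact le_max_right _ _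
  have h3 : I.2 ≤ e := by rw [hk]; exact min_le_right _ _
  exact ⟨h2, h1, h3, by omega⟩

theorem detection_left_lt {x : ℕ → ℝ} {lam : ℕ} {zeta : ℝ} {s e : ℕ} {I : ℕ × ℕ}
    (he : ¬ e - s < 3) (hI : detection x lam zeta s e = some I) : I.1 - s < e - s := by
  have := detection_bounds hI
  omega

theorem detection_right_lt {x : ℕ → ℝ} {lam : ℕ} {zeta : ℝ} {s e : ℕ} {I : ℕ × ℕ}
    (he : ¬ e - s < 3) (hI : detection x lam zeta s e = some I) : e - I.2 < e - s := by
  have := detection_bounds hI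
  omega

/-- The list of change-points estimated by `DAIS(s, e, λ, ζ)` from the data `x`. -/
def dais (x : ℕ → ℝ) (lam : ℕ) (zeta : ℝ) (s e : ℕ) : List ℕ :=
  if _he : e - s < 3 then []
  else
    match _hI : detection x lam zeta s e with
    | none => []
    | some I => bestSplit x I :: (dais x lam zeta s I.1 ++ dais x lam zeta I.2 e)
termination_by e - s
decreasing_by
  · exact detection_left_lt _he _hI
  · exact detection_right_lt _he _hI

/-- `Visits x λ ζ T s e`: in the run of the algorithm on the data `x 1, …, x T`, the recursion
calls `DAIS(s, e, λ, ζ)`. -/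
inductive Visits (x : ℕ → ℝ) (lam : ℕ) (zeta : ℝ) (T : ℕ) : ℕ → ℕ → Prop
  | start : Visits x lam zeta T 1 T
  | left {s e : ℕ} {I : ℕ × ℕ} (h : Visits x lam zeta T s e) (he : ¬ e - s < 3)
      (hI : detection x lam zeta s e = some I) : Visits x lam zeta T s I.1
  | right {s e : ℕ} {I : ℕ × ℕ} (h : Visits x lam zeta T s e) (he : ¬ e - s < 3)
      (hI : detection x lam zeta s e = some I) : Visits x lam zeta T I.2 e

/-- The number `N̂` of estimated change-points. -/
def estNum (x : ℕ → ℝ) (lam : ℕ) (zeta : ℝ) (T : ℕ) : ℕ := (dais x lam zeta 1 T).length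

/-- The estimated change-points `r̂_1 ≤ r̂_2 ≤ ⋯`, sorted in increasing order (indices from `1`). -/
def estLoc (x : ℕ → ℝ) (lam : ℕ) (zeta : ℝ) (T : ℕ) (j : ℕ) : ℕ :=
  ((dais x lam zeta 1 T).insertionSort (· ≤ ·)).getD (j - 1) 0

/-! ### The assumption on the location of the largest difference -/

/-- The admissible locations of the largest difference: not too close to the midpoint of two
consecutive change-points. -/
def admissible (n : ℝ) (T N : ℕ) (r : ℕ → ℕ) : Set ℝ :=
  Set.Icc 1 ((r 1 : ℝ) + (gap r 1 : ℝ) / 2 - 3 * (minGap N r : ℝ) / (4 * n)) ∪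
  Set.Icc ((r N : ℝ) - (gap r (N - 1) : ℝ) / 2 + 3 * (minGap N r : ℝ) / (4 * n)) ((T : ℝ) - 2) ∪
  ⋃ j ∈ Set.Icc 2 (N - 1),
    Set.Icc ((r j : ℝ) - (gap r (j - 1) : ℝ) / 2 + 3 * (minGap N r : ℝ) / (4 * n))
      ((r j : ℝ) + (gap r j : ℝ) / 2 - 3 * (minGap N r : ℝ) / (4 * n))

/-- Assumption on the run of the algorithm: every time it is applied to an interval `[s, e]` which
contains at least one change-point (and does not stop at once because of `e - s < 3`), the
location `d_{s,e}` of the largest difference is admissible. -/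
def LargestDiffAdmissible (n : ℝ) (T N : ℕ) (r : ℕ → ℕ) (x : ℕ → ℝ) (lam : ℕ) (zeta : ℝ) : Prop :=
  ∀ s e : ℕ, Visits x lam zeta T s e → ¬ e - s < 3 →
    (∃ j ∈ Finset.Icc 1 N, s ≤ r j ∧ r j ≤ e) →
      (largestDiff x s e : ℝ) ∈ admissible n T N r

/-- The number of change-points is estimated correctly and
`max_j |r̂_j - r_j| (Δ_j^f)^{2/3} ≤ C (log T)^{1/3}`. -/
def Consistent (C : ℝ) (T : ℕ) (f : ℕ → ℝ) (N : ℕ) (r : ℕ → ℕ) (x : ℕ → ℝ) (lam : ℕ)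
    (zeta : ℝ) : Prop :=
  estNum x lam zeta T = N ∧
    ∀ j ∈ Finset.Icc 1 N,
      |(estLoc x lam zeta T j : ℝ) - (r j : ℝ)| * jump f r j ^ ((2 : ℝ) / 3) ≤
        C * Real.log T ^ ((1 : ℝ) / 3)

end DAIS

end

noncomputable section

namespace DAIS

/-! ### The contrast vectors -/

/-! For s < b < e, `phi` is a unit vector, orthogonal to the affine functions, in the span of 1, t
and (t - b)₊ (`sum_phi_sq`, `sum_affine_mul_phi`, `exists_phi_form`). So the contrast sees a signal
only modulo affine functions. If the signal has a single kink, at r, the squared score at r exceeds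
that at b by the squared distance of the two projections (`HasKink.sum_sq_sub`), which is at least
a²m³/24 for a kink of size a and m = |b - r|, as long as radius m around r fits into the interval
(`kink_energy`).

Outside an event of probability at most 4/T, the noise is at most 4√(log T) in every contrast
direction, and at most 4√(log T) times the length in the direction of every difference of two such
projections (`exists_noiseBound_event`). The rest is deterministic. An interval on which the signal
is affine stays below the threshold, one with enough room around its only kink exceeds it
(`NoiseBound.lt_contrast`), and comparing the noise of a difference with the length of that same
difference localises the maximiser at the stated cube-root rate (`NoiseBound.abs_sub_pow_three_le`).

The checked intervals form an increasing chain, so the first detection lies inside any checked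
interval that exceeds the threshold. Since the expansion starts far from midpoints, one change-point
is nearest by a margin G, and it is covered with m points on each side before any other comes within
M. Each detection thus isolates one change-point, and both recursive calls inherit the margin M for
the others. This is the invariant `Isolates`, carried through the recursion in
`Isolates.exists_sorted_perm`. -/

theorem sum_range_quadratic (c₀ c₁ c₂ : ℝ) (m : ℕ) :
    ∑ i ∈ Finset.range m, (c₀ + c₁ * (i : ℝ) + c₂ * (i : ℝ) ^ 2) =
      c₀ * m + c₁ * (m * (m - 1) / 2) + c₂ * (m * (m - 1) * (2 * m - 1) / 6) := by
  induction m with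
  | zero => simp
  | succ k ih =>
    rw [Finset.sum_range_succ, ih]
    push_cast
    ring

theorem sum_Icc_split (g : ℕ → ℝ) (s p q : ℕ) :
    ∑ t ∈ Finset.Icc s (s + p + q), g t =
      ∑ i ∈ Finset.range (p + 1), g (s + i) + ∑ j ∈ Finset.range q, g (s + p + (j + 1)) := by
  rw [← Finset.Ico_add_one_right_eq_Icc, Finset.sum_Ico_eq_sum_range,
    show s + p + q + 1 - s = (p + 1) + q by omega, Finset.sum_range_add]
  congr 1
  refine Finset.sum_congr rfl fun j _ => ?_
  congr 1
  ring

theorem phi_eq_zero_of_eq (s e t : ℕ) : phi s e s t = 0 := by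
  simp [phi, phiBeta]

/-- With p = b - s, q = e - b, u = αβ and v = α/β, all square roots are confined to two polynomial
relations between u and v. Orthogonality and normalisation then become polynomial identities. -/
theorem exists_phi_coeffs (s : ℕ) {p q : ℕ} (hp : 1 ≤ p) (hq : 1 ≤ q) : ∃ u v : ℝ,
    (∀ i ≤ p, phi s (s + p + q) (s + p) (s + i) =
      u * ((3 * p + q + 2) * i - p * (p + q))) ∧
    (∀ j ≤ q, phi s (s + p + q) (s + p) (s + p + j) =
      -v * ((p + 3 * q + 2) * j - 2 * (q * (q + 1)))) ∧
    u * (p * (p + 1)) = v * (q * (q + 1)) ∧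
    u * v * (((p : ℝ) + q + 1) * ((p + q + 1) ^ 2 - 1) *
      (1 + (q + 1) * (p + 1) + q * p)) = 6 := by
  have hp' : (1 : ℝ) ≤ p := by exact_mod_cast hp
  have hq' : (1 : ℝ) ≤ q := by exact_mod_cast hq
  have hp0 : (0 : ℝ) < p := by linarith
  have hq0 : (0 : ℝ) < q := by linarith
  set D : ℝ := ((p : ℝ) + q + 1) * ((p + q + 1) ^ 2 - 1) *
      (1 + (q + 1) * (p + 1) + q * p) with hD
  have hD0 : 0 < D := by
    have : (0 : ℝ) < (p + q + 1) ^ 2 - 1 := by nlinarith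
    positivity
  set al : ℝ := phiAlpha (s : ℝ) ((s + p + q : ℕ) : ℝ) ((s + p : ℕ) : ℝ) with hal
  set be : ℝ := phiBeta (s : ℝ) ((s + p + q : ℕ) : ℝ) ((s + p : ℕ) : ℝ) with hbe
  have hbe' : be = √(((q + 1) * q) / ((p + 1) * p)) := by
    rw [hbe, phiBeta]
    congr 1
    push_cast
    ring_nf
  have hal' : al = √(6 / D) := by
    rw [hal, phiAlpha, hD]
    congr 1
    push_cast
    ring_nf
  have hb2 : be ^ 2 = ((q + 1) * q) / ((p + 1) * p) := by
    rw [hbe', Real.sq_sqrt (by positivity)]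
  have ha2 : al ^ 2 = 6 / D := by rw [hal', Real.sq_sqrt (by positivity)]
  have hb0 : 0 < be := by rw [hbe']; positivity
  have hleft : ∀ i ≤ p, phi s (s + p + q) (s + p) (s + i) =
      al * be * ((3 * p + q + 2) * i - p * (p + q)) := by
    intro i hi
    rw [phi, if_pos ⟨by omega, by omega⟩]
    push_cast at hal hbe ⊢
    rw [← hal, ← hbe]
    ring
  have huv : al * be * (p * (p + 1)) = al / be * (q * (q + 1)) := by
    have : be ^ 2 * (p * (p + 1)) = q * (q + 1) := by rw [hb2]; field_simp
    field_simp
    linear_combination al * this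
  refine ⟨al * be, al / be, hleft, ?_, huv, ?_⟩
  · intro j hj
    rcases Nat.eq_zero_or_pos j with rfl | hj0
    -- At the kink itself the definition uses the left branch. The relation between u and v says
    -- that the two branches meet there.
    · rw [Nat.add_zero, hleft p le_rfl]
      push_cast
      linear_combination 2 * huv
    · rw [phi, if_neg (by omega), if_pos ⟨by omega, by omega⟩]
      push_cast at hal hbe ⊢
      rw [← hal, ← hbe]
      ring
  · have : al * be * (al / be) = al ^ 2 := by field_simp
    rw [this, ha2]
    field_simp

theorem exists_phi_form {s b e : ℕ} (hsb : s < b) (hbe : b < e) : ∃ A B c : ℝ,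
    ∀ t ∈ Finset.Icc s e, phi s e b t = A + B * t + c * max ((t : ℝ) - b) 0 := by
  obtain ⟨p, rfl⟩ := Nat.exists_eq_add_of_le hsb.le
  obtain ⟨q, rfl⟩ := Nat.exists_eq_add_of_le hbe.le
  obtain ⟨u, v, h1, h2, h3, -⟩ := exists_phi_coeffs s (p := p) (q := q) (by omega) (by omega)
  refine ⟨-u * (p * (p + q)) - u * (3 * p + q + 2) * s, u * (3 * p + q + 2),
    -v * (p + 3 * q + 2) - u * (3 * p + q + 2), fun t ht => ?_⟩
  rw [Finset.mem_Icc] at ht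
  rcases le_total t (s + p) with h | h
  · obtain ⟨i, rfl⟩ := Nat.exists_eq_add_of_le ht.1
    rw [h1 i (by omega), max_eq_right]
    · push_cast
      ring
    · have : ((s + i : ℕ) : ℝ) ≤ ((s + p : ℕ) : ℝ) := by exact_mod_cast h
      linarith
  · obtain ⟨j, rfl⟩ := Nat.exists_eq_add_of_le h
    rw [h2 j (by omega), max_eq_left]
    · push_cast
      linear_combination (-2) * h3
    · push_cast
      have : (0 : ℝ) ≤ j := by positivity
      linarith

theorem sum_affine_mul_phi {s b e : ℕ} (hsb : s ≤ b) (hbe : b < e) (A B : ℝ) :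
    ∑ t ∈ Finset.Icc s e, (A + B * (t : ℝ)) * phi s e b t = 0 := by
  rcases hsb.eq_or_lt with rfl | hsb
  · simp [phi_eq_zero_of_eq]
  obtain ⟨p, rfl⟩ := Nat.exists_eq_add_of_le hsb.le
  obtain ⟨q, rfl⟩ := Nat.exists_eq_add_of_le hbe.le
  obtain ⟨u, v, h1, h2, h3, -⟩ := exists_phi_coeffs s (p := p) (q := q) (by omega) (by omega)
  have hq : (q : ℝ) ≠ 0 := by
    have : q ≠ 0 := by omega
    exact_mod_cast this
  have hv : v = u * (p * (p + 1)) / (q * (q + 1)) := by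
    have : (q : ℝ) + 1 ≠ 0 := by positivity
    rw [h3]
    field_simp
  rw [sum_Icc_split]
  have e1 : ∀ i ∈ Finset.range (p + 1),
      (A + B * ((s + i : ℕ) : ℝ)) * phi s (s + p + q) (s + p) (s + i) =
        (-(A + B * s) * u * (p * (p + q))) +
          ((A + B * s) * u * (3 * p + q + 2) - B * u * (p * (p + q))) * (i : ℝ) +
          (B * u * (3 * p + q + 2)) * (i : ℝ) ^ 2 := by
    intro i hi
    rw [h1 i (by simpa [Nat.lt_succ_iff] using hi)]
    push_cast
    ring
  have e2 : ∀ j ∈ Finset.range q,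
      (A + B * ((s + p + (j + 1) : ℕ) : ℝ)) * phi s (s + p + q) (s + p) (s + p + (j + 1)) =
        (-v * (A + B * (s + p + 1)) * (p + 3 * q + 2 - 2 * (q * (q + 1)))) +
          (-v * (A + B * (s + p + 1)) * (p + 3 * q + 2) -
            v * B * (p + 3 * q + 2 - 2 * (q * (q + 1)))) * (j : ℝ) +
          (-v * B * (p + 3 * q + 2)) * (j : ℝ) ^ 2 := by
    intro j hj
    have := Finset.mem_range.1 hj
    rw [h2 (j + 1) (by omega)]
    push_cast
    ring
  rw [Finset.sum_congr rfl e1, Finset.sum_congr rfl e2, sum_range_quadratic,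
    sum_range_quadratic, hv]
  push_cast
  field_simp
  ring

theorem sum_phi_sq {s b e : ℕ} (hsb : s < b) (hbe : b < e) :
    ∑ t ∈ Finset.Icc s e, phi s e b t ^ 2 = 1 := by
  obtain ⟨p, rfl⟩ := Nat.exists_eq_add_of_le hsb.le
  obtain ⟨q, rfl⟩ := Nat.exists_eq_add_of_le hbe.le
  obtain ⟨u, v, h1, h2, h3, h4⟩ := exists_phi_coeffs s (p := p) (q := q) (by omega) (by omega)
  have hq : (q : ℝ) ≠ 0 := by
    have : q ≠ 0 := by omega
    exact_mod_cast this
  have hq1 : (q : ℝ) + 1 ≠ 0 := by positivity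
  have hv : v = u * (p * (p + 1)) / (q * (q + 1)) := by
    rw [h3]
    field_simp
  rw [sum_Icc_split]
  have e1 : ∀ i ∈ Finset.range (p + 1),
      phi s (s + p + q) (s + p) (s + i) ^ 2 =
        u ^ 2 * (p * (p + q)) ^ 2 +
          (-2 * u ^ 2 * (p * (p + q)) * (3 * p + q + 2)) * (i : ℝ) +
          (u ^ 2 * (3 * p + q + 2) ^ 2) * (i : ℝ) ^ 2 := by
    intro i hi
    rw [h1 i (by simpa [Nat.lt_succ_iff] using hi)]
    ring
  have e2 : ∀ j ∈ Finset.range q,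
      phi s (s + p + q) (s + p) (s + p + (j + 1)) ^ 2 =
        v ^ 2 * (p + 3 * q + 2 - 2 * (q * (q + 1))) ^ 2 +
          (2 * v ^ 2 * (p + 3 * q + 2 - 2 * (q * (q + 1))) * (p + 3 * q + 2)) * (j : ℝ) +
          (v ^ 2 * (p + 3 * q + 2) ^ 2) * (j : ℝ) ^ 2 := by
    intro j hj
    have := Finset.mem_range.1 hj
    rw [h2 (j + 1) (by omega)]
    push_cast
    ring
  rw [Finset.sum_congr rfl e1, Finset.sum_congr rfl e2, sum_range_quadratic,
    sum_range_quadratic]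
  trans u * v * (((p : ℝ) + q + 1) * ((p + q + 1) ^ 2 - 1) *
      (1 + (q + 1) * (p + 1) + q * p)) / 6
  · rw [hv]
    push_cast
    field_simp
    ring
  · rw [h4]
    norm_num

/-! ### Least squares with one kink -/

/-- The signed contrast `⟨x, φ^b_{s,e}⟩`. -/
def score (x : ℕ → ℝ) (s e b : ℕ) : ℝ := ∑ t ∈ Finset.Icc s e, x t * phi s e b t

theorem contrast_eq_abs_score (x : ℕ → ℝ) (s e b : ℕ) : contrast x s e b = |score x s e b| := rfl

theorem score_add (x y : ℕ → ℝ) (s e b : ℕ) :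
    score (fun t => x t + y t) s e b = score x s e b + score y s e b := by
  simp [score, add_mul, Finset.sum_add_distrib]

theorem score_eq_zero_of_eq (x : ℕ → ℝ) (s e : ℕ) : score x s e s = 0 := by
  simp [score, phi_eq_zero_of_eq]

theorem sum_phi_sq_le {s b e : ℕ} (hsb : s ≤ b) (hbe : b < e) :
    ∑ t ∈ Finset.Icc s e, phi s e b t ^ 2 ≤ 1 := by
  rcases hsb.eq_or_lt with rfl | hsb
  · simp [phi_eq_zero_of_eq]
  · exact (sum_phi_sq hsb hbe).le

/-- On `[s, e]` the function `f` is affine up to a kink of size `a` at `r`. -/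
def HasKink (f : ℕ → ℝ) (s e r : ℕ) (a : ℝ) : Prop :=
  ∃ A B : ℝ, ∀ t ∈ Finset.Icc s e, f t = A + B * t + a * max ((t : ℝ) - r) 0

theorem score_congr_affine {f g : ℕ → ℝ} {s b e : ℕ} (hsb : s ≤ b) (hbe : b < e) {A B : ℝ}
    (h : ∀ t ∈ Finset.Icc s e, f t = A + B * t + g t) : score f s e b = score g s e b := by
  have : score f s e b = ∑ t ∈ Finset.Icc s e, (A + B * (t : ℝ)) * phi s e b t + score g s e b := by
    rw [score, score, ← Finset.sum_add_distrib]
    exact Finset.sum_congr rfl fun t ht => by rw [h t ht]; ring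
  rw [this, sum_affine_mul_phi hsb hbe, zero_add]

theorem score_affine {f : ℕ → ℝ} {s b e : ℕ} (hsb : s ≤ b) (hbe : b < e) {A B : ℝ}
    (h : ∀ t ∈ Finset.Icc s e, f t = A + B * t) : score f s e b = 0 := by
  rw [score_congr_affine hsb hbe (g := fun _ => 0) (A := A) (B := B) (by simpa using h)]
  simp [score]

theorem score_sq_le {f g : ℕ → ℝ} {s b e : ℕ} (hsb : s ≤ b) (hbe : b < e) {A B : ℝ}
    (h : ∀ t ∈ Finset.Icc s e, f t = A + B * t + g t) :
    score f s e b ^ 2 ≤ ∑ t ∈ Finset.Icc s e, g t ^ 2 := by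
  rw [score_congr_affine hsb hbe h]
  calc score g s e b ^ 2
      ≤ (∑ t ∈ Finset.Icc s e, g t ^ 2) * ∑ t ∈ Finset.Icc s e, phi s e b t ^ 2 :=
        Finset.sum_mul_sq_le_sq_mul_sq _ _ _
    _ ≤ (∑ t ∈ Finset.Icc s e, g t ^ 2) * 1 := by
        gcongr
        exact sum_phi_sq_le hsb hbe
    _ = _ := mul_one _

/-- Modulo affine functions, signals with a kink at r form a line, and `phi` is a unit vector on it.
The coefficient is therefore the inner product. -/
theorem HasKink.eq_affine_add {f : ℕ → ℝ} {s r e : ℕ} {a : ℝ} (hf : HasKink f s e r a)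
    (hsr : s < r) (hre : r < e) :
    ∃ A B : ℝ, ∀ t ∈ Finset.Icc s e, f t = A + B * t + score f s e r * phi s e r t := by
  obtain ⟨A, B, hf⟩ := hf
  obtain ⟨A', B', c, hphi⟩ := exists_phi_form hsr hre
  set K : ℝ := ∑ t ∈ Finset.Icc s e, max ((t : ℝ) - r) 0 * phi s e r t with hK
  -- Pair the kink form of `phi` with `phi`: the affine part drops out and the squared norm is 1.
  have h1 : c * K = 1 := by
    have h0 := sum_affine_mul_phi hsr.le hre A' B'
    rw [← sum_phi_sq hsr hre, ← sub_zero (∑ t ∈ Finset.Icc s e, phi s e r t ^ 2), ← h0, hK,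
      Finset.mul_sum, ← Finset.sum_sub_distrib]
    refine Finset.sum_congr rfl fun t ht => ?_
    linear_combination (-phi s e r t) * hphi t ht
  have h2 : score f s e r = a * K := by
    rw [score_congr_affine hsr.le hre hf, score, hK, Finset.mul_sum]
    exact Finset.sum_congr rfl fun t _ => by ring
  refine ⟨A - a * K * A', B - a * K * B', fun t ht => ?_⟩
  rw [h2, hphi t ht, hf t ht]
  linear_combination (-a * max ((t : ℝ) - r) 0) * h1

/-- Pythagoras: modulo affine functions f is its own projection to the direction of r, and its score
at b is the inner product of that projection with the direction of b. For b = s the second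
projection is zero. -/
theorem HasKink.sum_sq_sub {f : ℕ → ℝ} {s r b e : ℕ} {a : ℝ} (hf : HasKink f s e r a)
    (hsr : s < r) (hre : r < e) (hsb : s ≤ b) (hbe : b < e) :
    ∑ t ∈ Finset.Icc s e, (score f s e r * phi s e r t - score f s e b * phi s e b t) ^ 2 =
      score f s e r ^ 2 - score f s e b ^ 2 := by
  obtain ⟨A, B, h⟩ := hf.eq_affine_add hsr hre
  have h1 : score f s e b =
      ∑ t ∈ Finset.Icc s e, (score f s e r * phi s e r t) * phi s e b t :=
    score_congr_affine hsb hbe h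
  have h2 : score f s e b ^ 2 * ∑ t ∈ Finset.Icc s e, phi s e b t ^ 2 = score f s e b ^ 2 := by
    rcases hsb.eq_or_lt with rfl | hsb
    · simp [score_eq_zero_of_eq]
    · rw [sum_phi_sq hsb hbe, mul_one]
  have h3 : ∑ t ∈ Finset.Icc s e,
      (score f s e r * phi s e r t - score f s e b * phi s e b t) ^ 2 =
      score f s e r ^ 2 * ∑ t ∈ Finset.Icc s e, phi s e r t ^ 2 +
      score f s e b ^ 2 * ∑ t ∈ Finset.Icc s e, phi s e b t ^ 2 -
      2 * score f s e b * ∑ t ∈ Finset.Icc s e, (score f s e r * phi s e r t) * phi s e b t := by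
    simp only [Finset.mul_sum, ← Finset.sum_add_distrib, ← Finset.sum_sub_distrib]
    exact Finset.sum_congr rfl fun t _ => by ring
  rw [h3, h2, ← h1, sum_phi_sq hsr hre]
  ring

/-- Adding the values at r - i and r + i cancels the slope and leaves al + a·i, with al twice the
value at r of the affine part. The inequality (x + y)²/2 ≤ x² + y² reduces the claim to a quadratic
in al, bounded by completing the square. -/
theorem kink_energy {w : ℕ → ℝ} {r m : ℕ} (hm : m ≤ r) {A B a : ℝ}
    (hw : ∀ t ∈ Finset.Icc (r - m) (r + m), w t = A + B * t + a * max ((t : ℝ) - r) 0) :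
    a ^ 2 * (m : ℝ) ^ 3 / 24 ≤ ∑ t ∈ Finset.Icc (r - m) (r + m), w t ^ 2 := by
  set al : ℝ := 2 * (A + B * r) with hal
  have hr : w r = al / 2 := by
    rw [hw r (by simp)]
    simp [hal]
  have hpair : ∀ i ∈ Finset.range m, (al + a * ((i : ℝ) + 1)) ^ 2 / 2 ≤
      w (r - (i + 1)) ^ 2 + w (r + (i + 1)) ^ 2 := by
    intro i hi
    rw [Finset.mem_range] at hi
    have h1 : w (r - (i + 1)) = al / 2 - B * (i + 1) := by
      rw [hw _ (by rw [Finset.mem_Icc]; omega), Nat.cast_sub (by omega), max_eq_right]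
      · push_cast
        rw [hal]
        ring
      · push_cast
        have : (0 : ℝ) ≤ i := by positivity
        linarith
    have h2 : w (r + (i + 1)) = al / 2 + B * (i + 1) + a * (i + 1) := by
      rw [hw _ (by rw [Finset.mem_Icc]; omega), max_eq_left]
      · push_cast
        rw [hal]
        ring
      · push_cast
        have : (0 : ℝ) ≤ i := by positivity
        linarith
    rw [h1, h2]
    nlinarith [sq_nonneg (al / 2 - B * (i + 1) - (al / 2 + B * (i + 1) + a * (i + 1)))]
  have hsum : ∑ t ∈ Finset.Icc (r - m) (r + m), w t ^ 2 =
      w r ^ 2 + ∑ i ∈ Finset.range m, (w (r - (i + 1)) ^ 2 + w (r + (i + 1)) ^ 2) := by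
    have := sum_Icc_split (fun t => w t ^ 2) (r - m) m m
    rw [Nat.sub_add_cancel hm] at this
    rw [this, ← Finset.sum_range_reflect, Finset.sum_range_succ', Finset.sum_add_distrib]
    have e1 : ∀ i ∈ Finset.range m, w (r - m + (m + 1 - 1 - (i + 1))) ^ 2 =
        w (r - (i + 1)) ^ 2 := by
      intro i hi
      rw [Finset.mem_range] at hi
      congr 2
      omega
    rw [Finset.sum_congr rfl e1, show r - m + (m + 1 - 1 - 0) = r by omega]
    ring
  have hquad : ∑ i ∈ Finset.range m, (al + a * ((i : ℝ) + 1)) ^ 2 / 2 =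
      (al + a) ^ 2 / 2 * m + (al + a) * a * (m * (m - 1) / 2) +
        a ^ 2 / 2 * (m * (m - 1) * (2 * m - 1) / 6) := by
    rw [← sum_range_quadratic]
    exact Finset.sum_congr rfl fun i _ => by ring
  have hle := Finset.sum_le_sum hpair
  rw [hquad] at hle
  rw [hsum, hr]
  have hm0 : (0 : ℝ) ≤ m := by positivity
  refine le_trans ?_ (add_le_add_right hle _)
  -- The coefficient of al² is (2m + 1)/4. Multiplying by 2m + 1 completes the square without
  -- denominators.
  have h2m : (0 : ℝ) < 2 * m + 1 := by positivity
  refine le_of_mul_le_mul_left ?_ h2m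
  have : (2 * (m : ℝ) + 1) * ((al / 2) ^ 2 + ((al + a) ^ 2 / 2 * m +
      (al + a) * a * (m * (m - 1) / 2) + a ^ 2 / 2 * (m * (m - 1) * (2 * m - 1) / 6))) -
      (2 * m + 1) * (a ^ 2 * (m : ℝ) ^ 3 / 24) =
      ((2 * m + 1) * al + m * (m + 1) * a) ^ 2 / 4 +
        a ^ 2 * (m * (3 * (m : ℝ) ^ 2 + 4 * m + 2)) / 24 := by ring
  have h0 : 0 ≤ ((2 * m + 1) * al + m * (m + 1) * a) ^ 2 / 4 +
        a ^ 2 * (m * (3 * (m : ℝ) ^ 2 + 4 * m + 2)) / 24 := by positivity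
  linarith

/-- On the window of radius m around r the vector of b is affine, since b is not in its interior.
The difference of the projections therefore keeps the whole kink a there, and `kink_energy` applies.
-/
theorem HasKink.le_sq_sub_sq {f : ℕ → ℝ} {s r b e m : ℕ} {a : ℝ} (hf : HasKink f s e r a)
    (hsr : s < r) (hre : r < e) (hsb : s ≤ b) (hbe : b < e) (hms : s + m ≤ r) (hme : r + m ≤ e)
    (hmb : r + m ≤ b ∨ b + m ≤ r) :
    a ^ 2 * (m : ℝ) ^ 3 / 24 ≤ score f s e r ^ 2 - score f s e b ^ 2 := by
  rw [← hf.sum_sq_sub hsr hre hsb hbe]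
  obtain ⟨A, B, h⟩ := hf.eq_affine_add hsr hre
  obtain ⟨A₀, B₀, h₀⟩ := hf
  have hsub : Finset.Icc (r - m) (r + m) ⊆ Finset.Icc s e :=
    Finset.Icc_subset_Icc (by omega) hme
  have haff : ∃ A₁ B₁ : ℝ, ∀ t ∈ Finset.Icc (r - m) (r + m), phi s e b t = A₁ + B₁ * t := by
    rcases hsb.eq_or_lt with rfl | hsb
    · exact ⟨0, 0, fun t _ => by simp [phi_eq_zero_of_eq]⟩
    obtain ⟨A', B', c, hphi⟩ := exists_phi_form hsb hbe
    rcases hmb with hmb | hmb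
    · refine ⟨A', B', fun t ht => ?_⟩
      rw [hphi t (hsub ht), max_eq_right]
      · ring
      · rw [Finset.mem_Icc] at ht
        have : (t : ℝ) ≤ b := by exact_mod_cast ht.2.trans hmb
        linarith
    · refine ⟨A' - c * b, B' + c, fun t ht => ?_⟩
      rw [hphi t (hsub ht), max_eq_left]
      · ring
      · rw [Finset.mem_Icc] at ht
        have : (b : ℝ) ≤ t := by
          have : b ≤ t := by omega
          exact_mod_cast this
        linarith
  obtain ⟨A₁, B₁, h₁⟩ := haff
  refine le_trans ?_ (Finset.sum_le_sum_of_subset_of_nonneg hsub fun _ _ _ => sq_nonneg _)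
  refine kink_energy (A := A₀ - A - score f s e b * A₁) (B := B₀ - B - score f s e b * B₁)
    (by omega) fun t ht => ?_
  rw [h₁ t ht]
  linear_combination h₀ t (hsub ht) - h t (hsub ht)

/-- Compare with the split b = s, whose contrast vector vanishes. -/
theorem HasKink.le_sq {f : ℕ → ℝ} {s r e m : ℕ} {a : ℝ} (hf : HasKink f s e r a)
    (hm : 1 ≤ m) (hms : s + m ≤ r) (hme : r + m ≤ e) :
    a ^ 2 * (m : ℝ) ^ 3 / 24 ≤ score f s e r ^ 2 := by
  have := hf.le_sq_sub_sq (b := s) (by omega) (by omega) le_rfl (by omega) hms hme (Or.inr hms)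
  rwa [score_eq_zero_of_eq, zero_pow two_ne_zero, sub_zero] at this

/-- The score is at most the norm of any representative modulo affine functions. Take the hinge
supported on the shorter side of r. -/
theorem HasKink.sq_le {f : ℕ → ℝ} {s r e : ℕ} {a : ℝ} (hf : HasKink f s e r a)
    (hsr : s < r) (hre : r < e) :
    score f s e r ^ 2 ≤ a ^ 2 * ((min (r - s) (e - r) : ℕ) : ℝ) ^ 3 := by
  obtain ⟨A, B, h⟩ := hf
  rcases min_choice (r - s) (e - r) with hmin | hmin
  · rw [hmin]
    have h' : ∀ t ∈ Finset.Icc s e, f t = (A - a * r) + (B + a) * t +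
        a * max ((r : ℝ) - t) 0 := by
      intro t ht
      rw [h t ht]
      rcases le_total (t : ℝ) r with htr | htr
      · rw [max_eq_right (by linarith), max_eq_left (by linarith)]
        ring
      · rw [max_eq_left (by linarith), max_eq_right (by linarith)]
        ring
    refine (score_sq_le hsr.le hre h').trans ?_
    have hz : ∀ t ∈ Finset.Icc s e, t ∉ Finset.Ico s r →
        (a * max ((r : ℝ) - t) 0) ^ 2 = 0 := by
      intro t ht ht'
      rw [Finset.mem_Icc] at ht
      rw [Finset.mem_Ico] at ht'
      have : (r : ℝ) ≤ t := by
        have : r ≤ t := by omega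
        exact_mod_cast this
      rw [max_eq_right (by linarith)]
      ring
    rw [← Finset.sum_subset (fun t ht => by
      rw [Finset.mem_Ico] at ht; rw [Finset.mem_Icc]; omega) hz]
    calc ∑ t ∈ Finset.Ico s r, (a * max ((r : ℝ) - t) 0) ^ 2
        ≤ ∑ t ∈ Finset.Ico s r, a ^ 2 * ((r - s : ℕ) : ℝ) ^ 2 := by
          refine Finset.sum_le_sum fun t ht => ?_
          rw [mul_pow]
          rw [Finset.mem_Ico] at ht
          have h1 : (s : ℝ) ≤ t := by exact_mod_cast ht.1
          have h2 : (s : ℝ) ≤ r := by exact_mod_cast hsr.le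
          gcongr
          rw [Nat.cast_sub hsr.le]
          exact max_le (by linarith) (by linarith)
      _ = _ := by
          rw [Finset.sum_const, Nat.card_Ico, nsmul_eq_mul]
          ring
  · rw [hmin]
    refine (score_sq_le hsr.le hre h).trans ?_
    have hz : ∀ t ∈ Finset.Icc s e, t ∉ Finset.Ioc r e →
        (a * max ((t : ℝ) - r) 0) ^ 2 = 0 := by
      intro t ht ht'
      rw [Finset.mem_Icc] at ht
      rw [Finset.mem_Ioc] at ht'
      have : (t : ℝ) ≤ r := by
        have : t ≤ r := by omega
        exact_mod_cast this
      rw [max_eq_right (by linarith)]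
      ring
    rw [← Finset.sum_subset (fun t ht => by
      rw [Finset.mem_Ioc] at ht; rw [Finset.mem_Icc]; omega) hz]
    calc ∑ t ∈ Finset.Ioc r e, (a * max ((t : ℝ) - r) 0) ^ 2
        ≤ ∑ t ∈ Finset.Ioc r e, a ^ 2 * ((e - r : ℕ) : ℝ) ^ 2 := by
          refine Finset.sum_le_sum fun t ht => ?_
          rw [mul_pow]
          rw [Finset.mem_Ioc] at ht
          have h1 : (t : ℝ) ≤ e := by exact_mod_cast ht.2
          have h2 : (r : ℝ) ≤ e := by exact_mod_cast hre.le
          gcongr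
          rw [Nat.cast_sub hre.le]
          exact max_le (by linarith) (by linarith)
      _ = _ := by
          rw [Finset.sum_const, Nat.card_Ioc, nsmul_eq_mul]
          ring

/-! ### Consequences of a bound on the noise -/

section NoiseAndSignal

/-- The noise `z` is bounded by multiples of `L` in the directions of all contrast vectors, and
of the differences of the projections of `f` to two contrast vectors. -/
structure NoiseBound (f z : ℕ → ℝ) (T : ℕ) (L : ℝ) : Prop where
  score_le : ∀ s b e : ℕ, 1 ≤ s → s ≤ b → b < e → e ≤ T → |score z s e b| ≤ 4 * L
  diff_le : ∀ s r b e : ℕ, 1 ≤ s → s ≤ r → r < e → s ≤ b → b < e → e ≤ T →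
    |∑ t ∈ Finset.Icc s e, z t * (score f s e r * phi s e r t - score f s e b * phi s e b t)| ≤
      4 * L * √(∑ t ∈ Finset.Icc s e,
        (score f s e r * phi s e r t - score f s e b * phi s e b t) ^ 2)

variable {f z : ℕ → ℝ} {T : ℕ} {L zeta : ℝ}

theorem NoiseBound.contrast_le_of_affine (h : NoiseBound f z T L) {s b e : ℕ} (hs : 1 ≤ s)
    (hsb : s ≤ b) (hbe : b < e) (heT : e ≤ T) {A B : ℝ}
    (hf : ∀ t ∈ Finset.Icc s e, f t = A + B * t) :
    contrast (fun t => f t + z t) s e b ≤ 4 * L := by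
  rw [contrast_eq_abs_score, score_add, score_affine hsb hbe hf, zero_add]
  exact h.score_le s b e hs hsb hbe heT

theorem NoiseBound.lt_contrast (h : NoiseBound f z T L) (hL : 0 < L) (hz : 64 * L ≤ zeta)
    {s r e m : ℕ} {a : ℝ} (hs : 1 ≤ s) (heT : e ≤ T) (hf : HasKink f s e r a) (hm : 1 ≤ m)
    (hms : s + m ≤ r) (hme : r + m ≤ e) (ha : (2 * zeta) ^ 2 ≤ a ^ 2 * (m : ℝ) ^ 3 / 24) :
    zeta < contrast (fun t => f t + z t) s e r := by
  rw [contrast_eq_abs_score, score_add]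
  have h1 : 2 * zeta ≤ |score f s e r| := by
    refine le_of_sq_le_sq ?_ (abs_nonneg _)
    rw [sq_abs]
    exact ha.trans (hf.le_sq hm hms hme)
  have h2 := h.score_le s r e hs (by omega) (by omega) heT
  have h3 := abs_add_le (score f s e r + score z s e r) (-score z s e r)
  rw [add_neg_cancel_right, abs_neg] at h3
  linarith

/-- The drop y² of the squared score from r to b must be paid for by noise, whose main part is
itself at most 4Ly. Hence y is of order L, and the kink bound turns this into a bound on |b - r|. -/
theorem NoiseBound.abs_sub_pow_three_le (h : NoiseBound f z T L) (hL : 0 < L)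
    (hz : 64 * L ≤ zeta) {s r b e : ℕ} {a : ℝ} (hs : 1 ≤ s) (hsr : s < r) (hre : r < e)
    (hsb : s ≤ b) (hbe : b < e) (heT : e ≤ T) (hf : HasKink f s e r a)
    (hmax : contrast (fun t => f t + z t) s e r ≤ contrast (fun t => f t + z t) s e b)
    (hthr : zeta < contrast (fun t => f t + z t) s e b) :
    a ^ 2 * |(b : ℝ) - r| ^ 3 ≤ 3456 * L ^ 2 := by
  rw [contrast_eq_abs_score, contrast_eq_abs_score, score_add, score_add] at hmax
  rw [contrast_eq_abs_score, score_add] at hthr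
  have hd := h.diff_le s r b e hs hsr.le hre hsb hbe heT
  rw [hf.sum_sq_sub hsr hre hsb hbe] at hd
  have hdiff : ∑ t ∈ Finset.Icc s e,
      z t * (score f s e r * phi s e r t - score f s e b * phi s e b t) =
      score f s e r * score z s e r - score f s e b * score z s e b := by
    rw [score.eq_def z, score.eq_def z, Finset.mul_sum, Finset.mul_sum,
      ← Finset.sum_sub_distrib]
    exact Finset.sum_congr rfl fun t _ => by ring
  rw [hdiff] at hd
  have hQ0 : 0 ≤ score f s e r ^ 2 - score f s e b ^ 2 := by
    rw [← hf.sum_sq_sub hsr hre hsb hbe]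
    exact Finset.sum_nonneg fun _ _ => sq_nonneg _
  have hzb := h.score_le s b e hs hsb hbe heT
  have hzr := h.score_le s r e hs hsr.le hre heT
  have hsq := sq_le_sq.2 hmax
  set Fr := score f s e r
  set Fb := score f s e b
  set zr := score z s e r
  set zb := score z s e b
  set y := √(Fr ^ 2 - Fb ^ 2) with hy
  have hy2 : y ^ 2 = Fr ^ 2 - Fb ^ 2 := Real.sq_sqrt hQ0
  have hy0 : 0 ≤ y := Real.sqrt_nonneg _
  have hzb2 : zb ^ 2 ≤ (4 * L) ^ 2 := sq_le_sq.2 (hzb.trans (le_abs_self _))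
  -- Expand (Fr + zr)² ≤ (Fb + zb)²: twice the noise of the difference, plus zb², dominates Fr² -
  -- Fb².
  have hyle : y ^ 2 ≤ 8 * L * y + 16 * L ^ 2 := by
    have := neg_le_of_abs_le hd
    nlinarith [sq_nonneg zr]
  have hy12 : y ≤ 12 * L := by
    by_contra hcon
    push Not at hcon
    nlinarith
  have hQ : Fr ^ 2 - Fb ^ 2 ≤ 144 * L ^ 2 := by
    rw [← hy2]
    nlinarith
  have hFb : 60 * L < |Fb| := by
    have := abs_add_le Fb zb
    linarith
  have hFb2 : 3600 * L ^ 2 < Fb ^ 2 := by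
    rw [← sq_abs Fb]
    nlinarith
  set m := (b - r) + (r - b) with hm
  have hmabs : (m : ℝ) = |(b : ℝ) - r| := by
    rcases le_total b r with hbr | hbr
    · rw [hm, Nat.sub_eq_zero_of_le hbr, zero_add, Nat.cast_sub hbr, abs_sub_comm, abs_of_nonneg]
      simpa using hbr
    · rw [hm, Nat.sub_eq_zero_of_le hbr, add_zero, Nat.cast_sub hbr, abs_of_nonneg]
      simpa using hbr
  rw [← hmabs]
  rcases le_or_gt m (min (r - s) (e - r)) with hcase | hcase
  · have := hf.le_sq_sub_sq (b := b) (m := m) hsr hre hsb hbe (by omega) (by omega) (by omega)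
    linarith
  -- If b were farther from r than the nearer end-point, the drop would already be a fixed fraction
  -- of Fr². This gives Fr² ≤ 24 · 144 L² = 3456 L², against Fr² ≥ Fb² > 3600 L². The factor 64 in
  -- the threshold is what provides |Fb| > 60 L.
  · exfalso
    have h1 := hf.le_sq_sub_sq (b := b) (m := min (r - s) (e - r)) hsr hre hsb hbe
      (by omega) (by omega) (by omega)
    have h2 := hf.sq_le hsr hre
    have h3 : Fr ^ 2 ≤ 24 * (Fr ^ 2 - Fb ^ 2) := by linarith
    nlinarith

/-! ### The signal -/

variable {N : ℕ} {r : ℕ → ℕ}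

theorem minGap_le_gap {j : ℕ} (hj : j ≤ N) : minGap N r ≤ gap r j :=
  Finset.inf'_le _ (Finset.mem_range.2 (by omega))

namespace IsContPiecewiseLinear

theorem add_minGap_le (h : IsContPiecewiseLinear T f N r) {i j : ℕ} (hij : i < j)
    (hj : j ≤ N + 1) : r i + minGap N r ≤ r j := by
  induction j, hij using Nat.le_induction with
  | base =>
    have := minGap_le_gap (r := r) (show i ≤ N by omega)
    have := h.r_lt i (by omega)
    change r i + minGap N r ≤ r (i + 1)
    unfold gap at *
    omega
  | succ k hk ih =>
    have := h.r_lt k (by omega)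
    have := ih (by omega)
    omega

theorem strictMono (h : IsContPiecewiseLinear T f N r) {i j : ℕ} (hij : i < j)
    (hj : j ≤ N + 1) : r i < r j := by
  induction j, hij using Nat.le_induction with
  | base => exact h.r_lt i (by omega)
  | succ k hk ih =>
    have := h.r_lt k (by omega)
    have := ih (by omega)
    omega

theorem mono (h : IsContPiecewiseLinear T f N r) {i j : ℕ} (hij : i ≤ j)
    (hj : j ≤ N + 1) : r i ≤ r j := by
  rcases hij.eq_or_lt with rfl | hij
  · exact le_rfl
  · exact (h.strictMono hij hj).le

/-- Continuity extends each linear piece to its left change-point. Time 0 is excluded because `r 0 =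
0` is not an observation. -/
theorem exists_lines (h : IsContPiecewiseLinear T f N r) : ∃ A B : ℕ → ℝ, ∀ j ≤ N, ∀ t : ℕ,
    1 ≤ t → r j ≤ t → t ≤ r (j + 1) → f t = A j + B j * t := by
  obtain ⟨μ₁, μ₂, h1, h2⟩ := h.pieces
  refine ⟨fun j => μ₁ (j + 1), fun j => μ₂ (j + 1), fun j hj t ht1 ht ht' => ?_⟩
  rcases ht.eq_or_lt with rfl | ht
  · have hj0 : j ≠ 0 := by
      rintro rfl
      have := h.r_zero
      omega
    have hlt := h.strictMono (show j - 1 < j by omega) (by omega)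
    rw [h1 j (Finset.mem_Icc.2 (by omega)) _ (Finset.mem_Icc.2 (by omega)),
      h2 j (Finset.mem_Icc.2 (by omega))]
  · exact h1 (j + 1) (Finset.mem_Icc.2 (by omega)) t
      (Finset.mem_Icc.2 ⟨by simpa using ht, ht'⟩)

theorem exists_piece (h : IsContPiecewiseLinear T f N r) {s : ℕ} (hs : s < T) :
    ∃ j ≤ N, r j ≤ s ∧ s < r (j + 1) := by
  have hex : ∃ k, s < r (k + 1) := ⟨N, by rw [h.r_last]; exact hs⟩
  classical
  refine ⟨Nat.find hex, Nat.find_min' hex (by rw [h.r_last]; exact hs), ?_, Nat.find_spec hex⟩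
  rcases Nat.eq_zero_or_pos (Nat.find hex) with h0 | h0
  · rw [h0, h.r_zero]
    omega
  · have := Nat.find_min hex (show Nat.find hex - 1 < Nat.find hex by omega)
    rw [Nat.sub_add_cancel h0] at this
    omega

theorem exists_affine (h : IsContPiecewiseLinear T f N r) {s e : ℕ} (hs : 1 ≤ s) (hse : s < e)
    (he : e ≤ T) (hno : ∀ j ∈ Finset.Icc 1 N, ¬ (s < r j ∧ r j < e)) :
    ∃ A B : ℝ, ∀ t ∈ Finset.Icc s e, f t = A + B * t := by
  obtain ⟨A, B, hAB⟩ := h.exists_lines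
  obtain ⟨j, hj, h1, h2⟩ := h.exists_piece (show s < T by omega)
  have h3 : e ≤ r (j + 1) := by
    rcases hj.eq_or_lt with rfl | hj
    · rwa [h.r_last]
    · have := hno (j + 1) (Finset.mem_Icc.2 (by omega))
      omega
  refine ⟨A j, B j, fun t ht => ?_⟩
  rw [Finset.mem_Icc] at ht
  exact hAB j hj t (by omega) (by omega) (by omega)

theorem exists_hasKink (h : IsContPiecewiseLinear T f N r) {j s e : ℕ} (hj : j ∈ Finset.Icc 1 N)
    (hs : 1 ≤ s) (hsr : s < r j) (hre : r j < e) (h1 : r (j - 1) ≤ s) (h2 : e ≤ r (j + 1)) :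
    ∃ a : ℝ, |a| = jump f r j ∧ HasKink f s e (r j) a := by
  obtain ⟨A, B, hAB⟩ := h.exists_lines
  rw [Finset.mem_Icc] at hj
  have hl := hAB (j - 1) (by omega)
  rw [Nat.sub_add_cancel hj.1] at hl
  have hr := hAB j hj.2
  have e0 := hl (r j) (by omega) (by omega) le_rfl
  have e0' := hr (r j) (by omega) le_rfl (by omega)
  refine ⟨B j - B (j - 1), ?_, A (j - 1), B (j - 1), fun t ht => ?_⟩
  · have e1 := hl (r j - 1) (by omega) (by omega) (by omega)
    have e2 := hr (r j + 1) (by omega) (by omega) (by omega)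
    rw [Nat.cast_sub (by omega)] at e1
    push_cast at e1 e2
    rw [jump, ← abs_neg]
    congr 1
    linear_combination -e0 - e0' + e1 + e2
  · rw [Finset.mem_Icc] at ht
    rcases le_total t (r j) with htr | htr
    · have : (t : ℝ) ≤ r j := by exact_mod_cast htr
      rw [max_eq_right (by linarith), hl t (by omega) (by omega) htr]
      ring
    · have : (r j : ℝ) ≤ t := by exact_mod_cast htr
      rw [max_eq_left (by linarith), hr t (by omega) htr (by omega)]
      linear_combination e0 - e0'

end IsContPiecewiseLinear

end NoiseAndSignal

/-! ### The checked intervals -/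

theorem le_argmaxOn {S : Finset ℕ} (g : ℕ → ℝ) {u : ℕ} (hu : u ∈ S) : g u ≤ g (argmaxOn S g) := by
  obtain ⟨t, ht, hmax⟩ := S.exists_max_image g ⟨u, hu⟩
  exact (Nat.sInf_mem (s := {t | t ∈ S ∧ ∀ u ∈ S, g u ≤ g t}) ⟨t, ht, hmax⟩).2 u hu

section Intervals

variable {lam d s e : ℕ}

theorem leftPt_anti {m m' : ℕ} (h : m ≤ m') : leftPt lam d s m' ≤ leftPt lam d s m := by
  have : m * lam ≤ m' * lam := Nat.mul_le_mul_right _ h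
  unfold leftPt
  omega

theorem rightPt_mono {m m' : ℕ} (h : m ≤ m') : rightPt lam d e m ≤ rightPt lam d e m' := by
  have : m * lam ≤ m' * lam := Nat.mul_le_mul_right _ h
  unfold rightPt
  omega

/-- The order of the checks only ever enlarges the interval, so the list is a chain. -/
theorem pairwise_intervals (lam d s e : ℕ) :
    (intervals lam d s e).Pairwise fun I J => J.1 ≤ I.1 ∧ I.2 ≤ J.2 := by
  unfold intervals
  simp only
  rw [List.pairwise_append]
  refine ⟨?_, ?_, ?_⟩
  · rw [List.pairwise_flatMap]
    refine ⟨fun k _ => ?_, ?_⟩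
    · simp [leftPt_anti]
    · refine List.pairwise_lt_range.imp fun {k k'} hk => ?_
      intro I hI J hJ
      simp only [List.mem_cons, List.not_mem_nil, or_false] at hI hJ
      rcases hI with rfl | rfl <;> rcases hJ with rfl | rfl <;>
        exact ⟨leftPt_anti (by omega), rightPt_mono (by omega)⟩
  · rw [List.pairwise_map]
    refine List.pairwise_lt_range.imp fun {k k'} hk => ?_
    exact ⟨leftPt_anti (by omega), rightPt_mono (by omega)⟩
  · intro I hI J hJ
    simp only [List.mem_flatMap, List.mem_range, List.mem_map, List.mem_cons, List.not_mem_nil,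
      or_false] at hI hJ
    obtain ⟨k, hk, rfl | rfl⟩ := hI <;> obtain ⟨i, hi, rfl⟩ := hJ <;>
      exact ⟨leftPt_anti (by omega), rightPt_mono (by omega)⟩

theorem leftPt_eq (hlam : 1 ≤ lam) {m : ℕ} (hm : numLeft lam d s ≤ m) : leftPt lam d s m = s := by
  have hl : (0 : ℝ) < lam := by exact_mod_cast hlam
  have h1 : ((d : ℝ) - s + 1) / lam ≤ m := Nat.ceil_le.1 hm
  rw [div_le_iff₀ hl] at h1
  have h2 : d + 1 ≤ m * lam + s := by
    have : (d : ℝ) + 1 ≤ m * lam + s := by linarith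
    exact_mod_cast this
  unfold leftPt
  omega

theorem rightPt_eq (hlam : 1 ≤ lam) {m : ℕ} (hm : numRight lam d e ≤ m) :
    rightPt lam d e m = e := by
  have hl : (0 : ℝ) < lam := by exact_mod_cast hlam
  have h1 : ((e : ℝ) - d + 1) / lam ≤ m := Nat.ceil_le.1 hm
  rw [div_le_iff₀ hl] at h1
  have h2 : e + 1 ≤ m * lam + d := by
    have : (e : ℝ) + 1 ≤ m * lam + d := by linarith
    exact_mod_cast this
  unfold rightPt
  omega

theorem one_le_numLeft (hlam : 1 ≤ lam) (hsd : s ≤ d) : 1 ≤ numLeft lam d s := by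
  have hl : (0 : ℝ) < lam := by exact_mod_cast hlam
  have : (s : ℝ) ≤ d := by exact_mod_cast hsd
  exact Nat.ceil_pos.2 (div_pos (by linarith) hl)

theorem one_le_numRight (hlam : 1 ≤ lam) (hde : d ≤ e) : 1 ≤ numRight lam d e := by
  have hl : (0 : ℝ) < lam := by exact_mod_cast hlam
  have : (d : ℝ) ≤ e := by exact_mod_cast hde
  exact Nat.ceil_pos.2 (div_pos (by linarith) hl)

theorem pair_succ_mem_intervals_of_lt {k : ℕ} (hk : k < min (numLeft lam d s) (numRight lam d e)) :
    (leftPt lam d s k, rightPt lam d e (k + 1)) ∈ intervals lam d s e ∧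
      (leftPt lam d s (k + 1), rightPt lam d e (k + 1)) ∈ intervals lam d s e := by
  unfold intervals
  constructor <;> refine List.mem_append_left _ (List.mem_flatMap.2 ⟨k, List.mem_range.2 hk, ?_⟩)
    <;> simp

/-- Beyond the larger number of steps both end-points have reached s and e, so no upper bound on m
is needed. -/
theorem pair_mem_intervals (hlam : 1 ≤ lam) (hsd : s ≤ d) (hde : d ≤ e) {m : ℕ} (hm : 1 ≤ m) :
    (leftPt lam d s m, rightPt lam d e m) ∈ intervals lam d s e := by
  have hl := one_le_numLeft hlam hsd
  have hr := one_le_numRight hlam hde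
  have key : ∀ m, 1 ≤ m → m ≤ max (numLeft lam d s) (numRight lam d e) →
      (leftPt lam d s m, rightPt lam d e m) ∈ intervals lam d s e := by
    intro m hm hm'
    rcases le_or_gt m (min (numLeft lam d s) (numRight lam d e)) with h | h
    · have := (pair_succ_mem_intervals_of_lt (lam := lam) (d := d) (s := s) (e := e)
        (k := m - 1) (by omega)).2
      rwa [Nat.sub_add_cancel hm] at this
    · unfold intervals
      refine List.mem_append_right _ (List.mem_map.2
        ⟨m - (min (numLeft lam d s) (numRight lam d e) + 1), List.mem_range.2 (by omega), ?_⟩)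
      rw [Nat.add_sub_cancel' (by omega)]
  rcases le_or_gt m (max (numLeft lam d s) (numRight lam d e)) with h | h
  · exact key m hm h
  · have := key _ (by omega) le_rfl
    rw [leftPt_eq hlam (le_max_left _ _), rightPt_eq hlam (le_max_right _ _)] at this
    rwa [leftPt_eq hlam (by omega), rightPt_eq hlam (by omega)]

/-- Once one side is exhausted, its end-point no longer moves and the half-step pair coincides with
a pair of equal indices. -/
theorem pair_succ_mem_intervals (hlam : 1 ≤ lam) (hsd : s ≤ d) (hde : d ≤ e) (k : ℕ) :
    (leftPt lam d s k, rightPt lam d e (k + 1)) ∈ intervals lam d s e := by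
  have hl := one_le_numLeft hlam hsd
  have hr := one_le_numRight hlam hde
  rcases lt_or_ge k (min (numLeft lam d s) (numRight lam d e)) with h | h
  · exact (pair_succ_mem_intervals_of_lt h).1
  · rcases min_le_iff.1 h with h | h
    · have := pair_mem_intervals hlam hsd hde (m := k + 1) (by omega)
      rw [leftPt_eq hlam (h.trans (Nat.le_succ k))] at this
      rwa [leftPt_eq hlam h]
    · have := pair_mem_intervals hlam hsd hde (m := k) (by omega)
      rw [rightPt_eq hlam h] at this
      rwa [rightPt_eq hlam (h.trans (Nat.le_succ k))]

theorem le_ceilDiv_mul (hlam : 1 ≤ lam) (A : ℕ) : A ≤ (A + lam - 1) / lam * lam := by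
  have h1 := Nat.div_add_mod (A + lam - 1) lam
  have h2 := Nat.mod_lt (A + lam - 1) (show 0 < lam by omega)
  rw [mul_comm] at h1
  omega

/-- Some checked interval covers `[ρ - m, ρ + m]` without reaching much further. -/
theorem exists_covering_interval (hlam : 1 ≤ lam) (hs : 1 ≤ s) (hsd : s ≤ d) (hde : d ≤ e)
    {ρ m D : ℕ} (hsρ : s + m ≤ ρ) (hρe : ρ + m ≤ e) (hD : d ≤ ρ + D) (hD' : ρ ≤ d + D) :
    ∃ I ∈ intervals lam d s e, I.1 + m ≤ ρ ∧ ρ + m ≤ I.2 ∧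
      d + 1 ≤ I.1 + D + m + lam ∧ I.2 + 1 ≤ d + D + m + lam := by
  -- These are the fewest left and right expansions reaching ρ - m and ρ + m; the extra 1 in k
  -- compensates the -1 in `rightPt`. Right moves come first, so for a < k the pair (k - 1, k)
  -- suffices; otherwise take (a, a).
  set a := (d + m - ρ + lam - 1) / lam with ha
  set k := (ρ + m + 1 - d + lam - 1) / lam with hk
  have ha1 : d + m - ρ ≤ a * lam := le_ceilDiv_mul hlam _
  have hk1 : ρ + m + 1 - d ≤ k * lam := le_ceilDiv_mul hlam _
  have ha2 : a * lam ≤ d + m - ρ + lam - 1 := Nat.div_mul_le_self _ _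
  have hk2 : k * lam ≤ ρ + m + 1 - d + lam - 1 := Nat.div_mul_le_self _ _
  clear_value a k
  rcases lt_or_ge a k with hak | hak
  · obtain ⟨k', hk'⟩ : ∃ k', k = k' + 1 := ⟨k - 1, by omega⟩
    have h1 : a * lam ≤ k' * lam := Nat.mul_le_mul_right _ (by omega)
    rw [hk'] at hk1 hk2
    have h2 : (k' + 1) * lam = k' * lam + lam := by ring
    refine ⟨_, pair_succ_mem_intervals hlam hsd hde k', ?_⟩
    simp only [leftPt, rightPt]
    omega
  · have h1 : k * lam ≤ a * lam := Nat.mul_le_mul_right _ hak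
    have ha0 : 1 ≤ a := by
      by_contra hcon
      have : a = 0 := by omega
      rw [this, zero_mul] at ha1 h1
      omega
    refine ⟨_, pair_mem_intervals hlam hsd hde ha0, ?_⟩
    simp only [leftPt, rightPt]
    omega

end Intervals

/-! ### One call of the algorithm -/

section Detection

variable {x : ℕ → ℝ} {lam : ℕ} {zeta : ℝ} {s e : ℕ}

/-- By the chain property, the first success is contained in every other one. -/
theorem exists_detection {I : ℕ × ℕ} (hI : I ∈ intervals lam (largestDiff x s e) s e)
    (hex : Exceeds x zeta I) :
    ∃ J, detection x lam zeta s e = some J ∧ Exceeds x zeta J ∧ I.1 ≤ J.1 ∧ J.2 ≤ I.2 := by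
  classical
  unfold detection
  cases hfind : (intervals lam (largestDiff x s e) s e).find?
      (fun I => decide (Exceeds x zeta I)) with
  | none =>
    rw [List.find?_eq_none] at hfind
    exact absurd hex (by simpa using hfind I hI)
  | some J =>
    refine ⟨J, rfl, by simpa using List.find?_some hfind, ?_⟩
    obtain ⟨-, as, bs, hl, hnot⟩ := List.find?_eq_some_iff_append.1 hfind
    have hp := pairwise_intervals lam (largestDiff x s e) s e
    rw [hl] at hI hp
    rw [List.pairwise_append, List.pairwise_cons] at hp
    rcases List.mem_append.1 hI with h | h
    · exact absurd hex (by simpa using hnot I h)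
    · rcases List.mem_cons.1 h with rfl | h
      · exact ⟨le_rfl, le_rfl⟩
      · exact hp.2.1.1 I h

theorem exceeds_of_lt_contrast {I : ℕ × ℕ} {b : ℕ} (h1 : I.1 ≤ b) (h2 : b < I.2)
    (hb : zeta < contrast x I.1 I.2 b) : Exceeds x zeta I :=
  ⟨by omega, hb.trans_le (le_argmaxOn _ (Finset.mem_Ico.2 ⟨h1, h2⟩))⟩

theorem bestSplit_mem {I : ℕ × ℕ} (h : I.1 < I.2) : I.1 ≤ bestSplit x I ∧ bestSplit x I < I.2 :=
  Finset.mem_Ico.1 (argmaxOn_mem (Finset.nonempty_Ico.2 h) _)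

theorem largestDiff_mem (he : ¬ e - s < 3) :
    s ≤ largestDiff x s e ∧ largestDiff x s e ≤ e - 2 :=
  Finset.mem_Icc.1 (argmaxOn_mem (Finset.nonempty_Icc.2 (by omega)) _)

theorem dais_of_none (h : detection x lam zeta s e = none) : dais x lam zeta s e = [] := by
  rw [dais]
  split
  · rfl
  · split
    · rfl
    · simp_all

theorem dais_of_some {I : ℕ × ℕ} (he : ¬ e - s < 3) (h : detection x lam zeta s e = some I) :
    dais x lam zeta s e =
      bestSplit x I :: (dais x lam zeta s I.1 ++ dais x lam zeta I.2 e) := by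
  rw [dais, dif_neg he]
  split
  · simp_all
  · simp_all

end Detection

/-! ### The run of the algorithm -/

section Run

/-- Integer margins for the run of the algorithm: change-points stay at distance at least `M` from
the ends of every interval, a change is detected as soon as `m` observations on both of its sides
are available, and `G` bounds from below twice the distance of the largest difference from the
midpoints of consecutive change-points. -/
structure Margins (f : ℕ → ℝ) (N : ℕ) (r : ℕ → ℕ) (lam : ℕ) (zeta : ℝ) (m M G : ℕ) : Prop where
  one_le_lam : 1 ≤ lam
  one_le : 1 ≤ m
  le : m ≤ M
  two_le : 2 ≤ M
  add_le : M + m + lam ≤ G + 1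
  le_minGap : G ≤ minGap N r
  strong : ∀ j ∈ Finset.Icc 1 N, (2 * zeta) ^ 2 ≤ jump f r j ^ 2 * (m : ℝ) ^ 3 / 24

/-- `d` is far from the midpoints of consecutive change-points. -/
def FarFromMidpoints (N : ℕ) (r : ℕ → ℕ) (G d : ℕ) : Prop :=
  ∀ i, 1 ≤ i → i + 1 ≤ N → 2 * d + G ≤ r i + r (i + 1) ∨ r i + r (i + 1) + G ≤ 2 * d

/-- The change-points in `[s, e]` are `r (a + 1), …, r c`, and they are far from `s` and `e`. -/
structure Isolates (T N : ℕ) (r : ℕ → ℕ) (M s e a c : ℕ) : Prop where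
  one_le : 1 ≤ s
  le : s ≤ e
  le_T : e ≤ T
  a_le : a ≤ c
  c_le : c ≤ N
  left : r a ≤ s
  right : e ≤ r (c + 1)
  left_add_le : ∀ i, a < i → i ≤ c → s + M ≤ r i
  add_le_right : ∀ i, a < i → i ≤ c → r i + M ≤ e

variable {f z : ℕ → ℝ} {T N : ℕ} {r : ℕ → ℕ} {L zeta : ℝ} {lam m M G s e a c : ℕ}

/-- Between two change-points, distance from the midpoint becomes a difference G of the two
distances; on the outer sides the minimal gap gives the same margin. -/
theorem exists_nearest (h : IsContPiecewiseLinear T f N r) (hG : 1 ≤ G) (hG' : G ≤ minGap N r)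
    (hac : a < c) (hc : c ≤ N) {d : ℕ} (hd : FarFromMidpoints N r G d) :
    ∃ j D, a < j ∧ j ≤ c ∧ d ≤ r j + D ∧ r j ≤ d + D ∧
      (∀ i, a < i → i < j → r i + D + G ≤ d) ∧ ∀ i, j < i → i ≤ c → d + D + G ≤ r i := by
  obtain ⟨j, hj, hmin⟩ := (Finset.Ioc a c).exists_min_image
    (fun i => (d - r i) + (r i - d)) (Finset.nonempty_Ioc.2 hac)
  rw [Finset.mem_Ioc] at hj
  refine ⟨j, (d - r j) + (r j - d), hj.1, hj.2, by omega, by omega, fun i hai hij => ?_,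
    fun i hji hic => ?_⟩
  · have h1 := h.mono (show i ≤ j - 1 by omega) (by omega)
    have h2 := h.add_minGap_le (show j - 1 < j by omega) (by omega)
    rcases le_or_gt (r j) d with hle | hgt
    · omega
    · have h3 := hd (j - 1) (by omega) (by omega)
      rw [Nat.sub_add_cancel (by omega)] at h3
      have h4 := hmin (j - 1) (Finset.mem_Ioc.2 (by omega))
      omega
  · have h1 := h.mono (show j + 1 ≤ i by omega) (by omega)
    have h2 := h.add_minGap_le (show j < j + 1 by omega) (by omega)
    rcases le_or_gt d (r j) with hle | hgt
    · omega
    · have h3 := hd j (by omega) (by omega)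
      have h4 := hmin (j + 1) (Finset.mem_Ioc.2 (by omega))
      omega

theorem not_exceeds (h : IsContPiecewiseLinear T f N r) (hz : NoiseBound f z T L) (hL : 0 < L)
    (hzeta : 64 * L ≤ zeta) {I : ℕ × ℕ} (h1 : 1 ≤ I.1) (hT : I.2 ≤ T)
    (hno : ∀ j ∈ Finset.Icc 1 N, ¬ (I.1 < r j ∧ r j < I.2)) :
    ¬ Exceeds (fun t => f t + z t) zeta I := by
  rintro ⟨hlt, hex⟩
  obtain ⟨A, B, hAB⟩ := h.exists_affine h1 hlt hT hno
  have hb := bestSplit_mem (x := fun t => f t + z t) hlt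
  have := hz.contrast_le_of_affine h1 hb.1 hb.2 hT hAB
  linarith

theorem mem_bounds_of_mem_intervals {d : ℕ} {I : ℕ × ℕ} (hI : I ∈ intervals lam d s e) :
    s ≤ I.1 ∧ I.2 ≤ e := by
  obtain ⟨⟨m, hm⟩, ⟨k, hk⟩⟩ := endpoints_of_mem_intervals hI
  exact ⟨by rw [hm]; exact le_max_right _ _, by rw [hk]; exact min_le_right _ _⟩

namespace Isolates

theorem between (h : IsContPiecewiseLinear T f N r) (hI : Isolates T N r M s e a c) {i : ℕ}
    (hi : i ∈ Finset.Icc 1 N) (h1 : s < r i) (h2 : r i < e) : a < i ∧ i ≤ c := by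
  rw [Finset.mem_Icc] at hi
  have := hI.left
  have := hI.right
  have := hI.a_le
  have := hI.c_le
  constructor
  · by_contra hcon
    have := h.mono (show i ≤ a by omega) (by omega)
    omega
  · by_contra hcon
    have := h.mono (show c + 1 ≤ i by omega) (by omega)
    omega

theorem detection_eq_none (h : IsContPiecewiseLinear T f N r) (hz : NoiseBound f z T L)
    (hL : 0 < L) (hzeta : 64 * L ≤ zeta) (hI : Isolates T N r M s e a a) :
    detection (fun t => f t + z t) lam zeta s e = none := by
  classical
  unfold detection
  refine List.find?_eq_none.2 fun I hmem => ?_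
  have hb := mem_bounds_of_mem_intervals hmem
  have := hI.one_le
  have := hI.le_T
  have := not_exceeds h hz hL hzeta (I := I) (by omega) (by omega) fun j hj hj' => by
    have := hI.between h hj (by omega) (by omega)
    omega
  simpa using this

/-- A call on an interval with a change-point detects exactly one change-point. -/
theorem exists_detection (h : IsContPiecewiseLinear T f N r) (hz : NoiseBound f z T L)
    (hL : 0 < L) (hzeta : 64 * L ≤ zeta) (hM : Margins f N r lam zeta m M G)
    (hI : Isolates T N r M s e a c) (hac : a < c)
    (hfar : FarFromMidpoints N r G (largestDiff (fun t => f t + z t) s e)) :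
    ∃ J j, detection (fun t => f t + z t) lam zeta s e = some J ∧ a < j ∧ j ≤ c ∧
      s ≤ J.1 ∧ J.2 ≤ e ∧ J.1 < r j ∧ r j < J.2 ∧
      (∀ i, a < i → i < j → r i + M ≤ J.1) ∧ (∀ i, j < i → i ≤ c → J.2 + M ≤ r i) ∧
      J.1 ≤ bestSplit (fun t => f t + z t) J ∧ bestSplit (fun t => f t + z t) J ≤ J.2 ∧
      jump f r j ^ 2 * |(bestSplit (fun t => f t + z t) J : ℝ) - r j| ^ 3 ≤ 3456 * L ^ 2 := by
  set x : ℕ → ℝ := fun t => f t + z t with hx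
  have hs1 := hI.one_le
  have heT := hI.le_T
  have hcN := hI.c_le
  have hleft := hI.left
  have hright := hI.right
  have hm1 := hM.one_le
  have hmM := hM.le
  have hM2 := hM.two_le
  have hadd := hM.add_le
  have hlam := hM.one_le_lam
  have hse : ¬ e - s < 3 := by
    have := hI.left_add_le c hac le_rfl
    have := hI.add_le_right c hac le_rfl
    omega
  have hd := largestDiff_mem (x := x) hse
  obtain ⟨j, D, haj, hjc, hD, hD', hbefore, hafter⟩ :=
    exists_nearest h (by omega) hM.le_minGap hac hcN hfar
  have hjs := hI.left_add_le j haj hjc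
  have hje := hI.add_le_right j haj hjc
  have hjN : j ∈ Finset.Icc 1 N := Finset.mem_Icc.2 (by omega)
  obtain ⟨I, hmem, hI1, hI2, hIl, hIr⟩ := exists_covering_interval (e := e) (lam := lam) hlam hs1 hd.1
    (by omega) (ρ := r j) (m := m) (D := D) (by omega) (by omega) hD hD'
  have hIb := mem_bounds_of_mem_intervals hmem
  -- The interval reaches at most D + m + lam - 1 from d, while every other change-point is at least
  -- D + G away; what remains is at least M.
  have hprev : ∀ i, a < i → i < j → r i + M ≤ I.1 := fun i h1 h2 => by
    have := hbefore i h1 h2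
    omega
  have hnext : ∀ i, j < i → i ≤ c → I.2 + M ≤ r i := fun i h1 h2 => by
    have := hafter i h1 h2
    omega
  have hprev' : r (j - 1) ≤ I.1 := by
    rcases Nat.eq_or_lt_of_le (show a ≤ j - 1 by omega) with h0 | h0
    · rw [← h0]
      omega
    · have := hprev (j - 1) h0 (by omega)
      omega
  have hnext' : I.2 ≤ r (j + 1) := by
    rcases Nat.eq_or_lt_of_le hjc with h0 | h0
    · rw [h0]
      omega
    · have := hnext (j + 1) (by omega) (by omega)
      omega
  have hexI : Exceeds x zeta I := by
    obtain ⟨κ, hκ, hkink⟩ := h.exists_hasKink hjN (s := I.1) (e := I.2) (by omega) (by omega)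
      (by omega) hprev' hnext'
    refine exceeds_of_lt_contrast (b := r j) (by omega) (by omega) ?_
    refine hz.lt_contrast hL hzeta (by omega) (by omega) hkink hm1 hI1 hI2 ?_
    rw [← sq_abs κ, hκ]
    exact hM.strong j hjN
  obtain ⟨J, hJ, hexJ, hIJ1, hIJ2⟩ := DAIS.exists_detection hmem hexI
  have hJb := detection_bounds hJ
  obtain ⟨i, hiN, hi1, hi2⟩ : ∃ i ∈ Finset.Icc 1 N, J.1 < r i ∧ r i < J.2 := by
    by_contra hcon
    push Not at hcon
    refine not_exceeds h hz hL hzeta (I := J) (by omega) (by omega) ?_ hexJ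
    rintro i hi ⟨h1, h2⟩
    have := hcon i hi h1
    omega
  have hiac := hI.between h hiN (by omega) (by omega)
  -- The detecting interval must contain a change-point, and it lies in I, where only r j is
  -- available.
  obtain rfl : i = j := by
    rcases lt_trichotomy i j with hij | hij | hij
    · have := hprev i hiac.1 hij
      omega
    · exact hij
    · have := hnext i hij hiac.2
      omega
  have hb := bestSplit_mem (x := x) hexJ.1
  obtain ⟨κ, hκ, hkink⟩ := h.exists_hasKink hjN (s := J.1) (e := J.2) (by omega) hi1 hi2
    (by omega) (by omega)
  refine ⟨J, i, hJ, haj, hjc, hJb.1, hJb.2.2.1, hi1, hi2, fun k h1 h2 => ?_, fun k h1 h2 => ?_,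
    hb.1, hb.2.le, ?_⟩
  · exact (hprev k h1 h2).trans hIJ1
  · exact (Nat.add_le_add_right hIJ2 M).trans (hnext k h1 h2)
  · rw [← hκ, sq_abs]
    exact hz.abs_sub_pow_three_le hL hzeta (by omega) hi1 hi2 hb.1 hb.2 (by omega) hkink
      (le_argmaxOn _ (Finset.mem_Ico.2 ⟨hi1.le, hi2⟩)) hexJ.2

/-- Induction on e - s. The output lists the split before the two sub-calls, so a sorted
rearrangement is built in which the k-th entry estimates the k-th change-point. -/
theorem exists_sorted_perm (h : IsContPiecewiseLinear T f N r) (hz : NoiseBound f z T L)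
    (hL : 0 < L) (hzeta : 64 * L ≤ zeta) (hM : Margins f N r lam zeta m M G)
    (hfar : ∀ s e, Visits (fun t => f t + z t) lam zeta T s e → ¬ e - s < 3 →
      (∃ j ∈ Finset.Icc 1 N, s ≤ r j ∧ r j ≤ e) →
        FarFromMidpoints N r G (largestDiff (fun t => f t + z t) s e))
    (hI : Isolates T N r M s e a c) (hv : Visits (fun t => f t + z t) lam zeta T s e) :
    ∃ l : List ℕ, l.Perm (dais (fun t => f t + z t) lam zeta s e) ∧ l.Pairwise (· ≤ ·) ∧
      (∀ b ∈ l, s ≤ b ∧ b ≤ e) ∧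
      List.Forall₂ (fun b j : ℕ => jump f r j ^ 2 * |(b : ℝ) - r j| ^ 3 ≤ 3456 * L ^ 2) l
        (List.range' (a + 1) (c - a)) := by
  induction hlen : e - s using Nat.strong_induction_on generalizing s e a c with
  | _ len ih =>
  rcases hI.a_le.eq_or_lt with rfl | hac
  · refine ⟨[], ?_, by simp, by simp, by simp⟩
    rw [dais_of_none (hI.detection_eq_none h hz hL hzeta)]
  · have hM2 := hM.two_le
    have h1 := hI.left_add_le c hac le_rfl
    have h2 := hI.add_le_right c hac le_rfl
    have hse : ¬ e - s < 3 := by omega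
    have hs1 := hI.one_le
    have heT := hI.le_T
    have hcN := hI.c_le
    obtain ⟨J, j, hJ, haj, hjc, hsJ, hJe, hJ1, hJ2, hprev, hnext, hb1, hb2, hacc⟩ :=
      hI.exists_detection h hz hL hzeta hM hac
        (hfar s e hv hse ⟨c, Finset.mem_Icc.2 (by omega), by omega, by omega⟩)
    have hIl : Isolates T N r M s J.1 a (j - 1) :=
      { one_le := hs1
        le := hsJ
        le_T := by omega
        a_le := by omega
        c_le := by omega
        left := hI.left
        right := by rw [Nat.sub_add_cancel (by omega)]; omega
        left_add_le := fun i hi1 hi2 => hI.left_add_le i hi1 (by omega)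
        add_le_right := fun i hi1 hi2 => hprev i hi1 (by omega) }
    have hIr : Isolates T N r M J.2 e j c :=
      { one_le := by omega
        le := hJe
        le_T := heT
        a_le := hjc
        c_le := hcN
        left := hJ2.le
        right := hI.right
        left_add_le := fun i hi1 hi2 => hnext i hi1 hi2
        add_le_right := fun i hi1 hi2 => hI.add_le_right i (by omega) hi2 }
    obtain ⟨l₁, hp1, hs1', hb1', hf1⟩ := ih _ (by omega) hIl (hv.left hse hJ) rfl
    obtain ⟨l₂, hp2, hs2', hb2', hf2⟩ := ih _ (by omega) hIr (hv.right hse hJ) rfl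
    -- Left estimates are at most `J.1`, right ones at least `J.2`, and the split lies between them,
    -- so concatenation is sorted.
    refine ⟨l₁ ++ bestSplit (fun t => f t + z t) J :: l₂, ?_, ?_, ?_, ?_⟩
    · rw [dais_of_some hse hJ]
      exact List.perm_middle.trans ((hp1.append hp2).cons _)
    · rw [List.pairwise_append, List.pairwise_cons]
      refine ⟨hs1', ⟨fun b hb => hb2.trans (hb2' b hb).1, hs2'⟩, fun b hb b' hb' => ?_⟩
      have := hb1' b hb
      rcases List.mem_cons.1 hb' with rfl | hb'
      · omega
      · have := hb2' b' hb'
        omega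
    · intro b hb
      rcases List.mem_append.1 hb with hb | hb
      · have := hb1' b hb
        omega
      · rcases List.mem_cons.1 hb with rfl | hb
        · omega
        · have := hb2' b hb
          omega
    · have hrange : List.range' (a + 1) (c - a) =
          List.range' (a + 1) (j - 1 - a) ++ j :: List.range' (j + 1) (c - j) := by
        rw [show c - a = (j - 1 - a) + ((c - j) + 1) by omega, ← List.range'_append_1,
          show a + 1 + (j - 1 - a) = j by omega, List.range'_succ]
      rw [hrange]
      exact List.rel_append hf1 (List.Forall₂.cons hacc hf2)

end Isolates

/-- The deterministic part of the consistency of the algorithm. -/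
theorem estimates_of_noiseBound (h : IsContPiecewiseLinear T f N r) (hz : NoiseBound f z T L)
    (hL : 0 < L) (hzeta : 64 * L ≤ zeta) (hM : Margins f N r lam zeta m M G)
    (hstart : M + 1 ≤ minGap N r)
    (hfar : ∀ s e, Visits (fun t => f t + z t) lam zeta T s e → ¬ e - s < 3 →
      (∃ j ∈ Finset.Icc 1 N, s ≤ r j ∧ r j ≤ e) →
        FarFromMidpoints N r G (largestDiff (fun t => f t + z t) s e)) :
    estNum (fun t => f t + z t) lam zeta T = N ∧ ∀ j ∈ Finset.Icc 1 N,
      jump f r j ^ 2 * |(estLoc (fun t => f t + z t) lam zeta T j : ℝ) - r j| ^ 3 ≤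
        3456 * L ^ 2 := by
  have hr0 := h.r_zero
  have hrT := h.r_last
  have hT := h.add_minGap_le (show 0 < N + 1 by omega) le_rfl
  -- The run starts at 1 while `r 0 = 0`; hence the extra 1 in `hstart`.
  have hI : Isolates T N r M 1 T 0 N :=
    { one_le := le_rfl
      le := by omega
      le_T := le_rfl
      a_le := by omega
      c_le := le_rfl
      left := by omega
      right := by omega
      left_add_le := fun i h1 h2 => by
        have := h.add_minGap_le h1 (by omega)
        omega
      add_le_right := fun i h1 h2 => by
        have := h.add_minGap_le (show i < N + 1 by omega) le_rfl
        omega }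
  obtain ⟨l, hp, hsort, -, hf⟩ := hI.exists_sorted_perm h hz hL hzeta hM hfar .start
  have hlen := hf.length_eq
  rw [List.length_range', Nat.sub_zero] at hlen
  refine ⟨by rw [estNum, ← hp.length_eq, hlen], fun j hj => ?_⟩
  rw [Finset.mem_Icc] at hj
  have hins : (dais (fun t => f t + z t) lam zeta 1 T).insertionSort (· ≤ ·) = l :=
    ((List.perm_insertionSort _ _).trans hp.symm).eq_of_pairwise'
      (List.pairwise_insertionSort _ _) hsort
  have := List.Forall₂.get hf (i := j - 1) (by omega) (by simp; omega)
  rw [estLoc, hins, List.getD_eq_getElem _ _ (show j - 1 < l.length by omega)]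
  simp only [List.get_eq_getElem, List.getElem_range'] at this
  rwa [show 0 + 1 + 1 * (j - 1) = j by omega] at this

end Run

/-! ### The constants -/

section Constants

variable {f : ℕ → ℝ} {T N : ℕ} {r : ℕ → ℕ} {n zeta : ℝ} {lam : ℕ}

theorem two_mul_le_minGap (hn : 3 / 2 ≤ n) (hlam : 1 ≤ lam)
    (hlam' : (lam : ℝ) ≤ (minGap N r : ℝ) / (2 * n)) : 2 * n ≤ (minGap N r : ℝ) := by
  have : (1 : ℝ) ≤ lam := by exact_mod_cast hlam
  rw [le_div_iff₀ (by linarith)] at hlam'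
  nlinarith

/-- In units of q = δ/(4n) the margins are q, 3q and 6q, and lam ≤ 2q. Their budget 3q + q + 2q = 6q
is exact up to rounding, and n ≥ 3/2 says precisely that 6q ≤ δ. -/
theorem margins (hn : 3 / 2 ≤ n) (hlam : 1 ≤ lam)
    (hlam' : (lam : ℝ) ≤ (minGap N r : ℝ) / (2 * n)) (hzeta : 0 ≤ zeta)
    (hsmall : ∀ j ∈ Finset.Icc 1 N,
      zeta < 1 / (80 * n ^ 2) * (minGap N r : ℝ) ^ ((3 : ℝ) / 2) * jump f r j) :
    Margins f N r lam zeta ⌈(minGap N r : ℝ) / (4 * n)⌉₊ ⌈3 * (minGap N r : ℝ) / (4 * n)⌉₊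
      ⌈3 * (minGap N r : ℝ) / (2 * n)⌉₊ := by
  have hn0 : 0 < n := by linarith
  have h2n := two_mul_le_minGap hn hlam hlam'
  set δ := minGap N r with hδ
  have hδ0 : (0 : ℝ) < δ := by linarith
  have hq : 0 < (δ : ℝ) / (4 * n) := by positivity
  have e3 : 3 * (δ : ℝ) / (4 * n) = 3 * (δ / (4 * n)) := by ring
  have e6 : 3 * (δ : ℝ) / (2 * n) = 6 * (δ / (4 * n)) := by field_simp; norm_num
  have e2 : (δ : ℝ) / (2 * n) = 2 * (δ / (4 * n)) := by field_simp; norm_num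
  have hq2 : 1 / 2 ≤ (δ : ℝ) / (4 * n) := by
    rw [le_div_iff₀ (by linarith)]
    linarith
  have h6 : 6 * ((δ : ℝ) / (4 * n)) ≤ δ := by
    rw [← e6, div_le_iff₀ (by linarith)]
    nlinarith
  rw [e3, e6]
  rw [e2] at hlam'
  set q := (δ : ℝ) / (4 * n) with hqdef
  refine ⟨hlam, Nat.ceil_pos.2 hq, Nat.ceil_mono (by linarith), ?_, ?_, ?_, ?_⟩
  · exact Nat.lt_ceil.2 (by push_cast; linarith)
  · have h1 := Nat.ceil_lt_add_one hq.le
    have h2 := Nat.ceil_lt_add_one (show 0 ≤ 3 * q by linarith)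
    have h3 := Nat.le_ceil (6 * q)
    have : ((⌈3 * q⌉₊ + ⌈q⌉₊ + lam : ℕ) : ℝ) < (⌈6 * q⌉₊ + 2 : ℕ) := by
      push_cast
      linarith
    have : ⌈3 * q⌉₊ + ⌈q⌉₊ + lam < ⌈6 * q⌉₊ + 2 := by exact_mod_cast this
    omega
  · exact Nat.ceil_le.2 h6
  · intro j hj
    have hz := hsmall j hj
    have hJ : 0 ≤ jump f r j := abs_nonneg _
    have hpow : ((δ : ℝ) ^ ((3 : ℝ) / 2)) ^ 2 = (δ : ℝ) ^ 3 := by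
      rw [← Real.rpow_natCast, ← Real.rpow_mul hδ0.le, ← Real.rpow_natCast]
      norm_num
    have h1 : (2 * zeta) ^ 2 ≤
        (2 * (1 / (80 * n ^ 2) * (δ : ℝ) ^ ((3 : ℝ) / 2) * jump f r j)) ^ 2 := by
      gcongr
    have h2 : (2 * (1 / (80 * n ^ 2) * (δ : ℝ) ^ ((3 : ℝ) / 2) * jump f r j)) ^ 2 =
        jump f r j ^ 2 * (q ^ 3 * (1 / (25 * n))) := by
      rw [mul_pow, mul_pow, mul_pow, hpow, hqdef]
      field_simp
      ring
    -- The factor 80n² was chosen so that this reduces to 25n ≥ 24.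
    have h3 : q ^ 3 * (1 / (25 * n)) ≤ (⌈q⌉₊ : ℝ) ^ 3 * (1 / 24) := by
      have := Nat.le_ceil q
      gcongr
      linarith
    calc (2 * zeta) ^ 2 ≤ jump f r j ^ 2 * (q ^ 3 * (1 / (25 * n))) := by rw [← h2]; exact h1
      _ ≤ jump f r j ^ 2 * ((⌈q⌉₊ : ℝ) ^ 3 * (1 / 24)) := by gcongr
      _ = _ := by ring

theorem margin_add_one_le_minGap (hn : 3 / 2 ≤ n) (hlam : 1 ≤ lam)
    (hlam' : (lam : ℝ) ≤ (minGap N r : ℝ) / (2 * n)) :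
    ⌈3 * (minGap N r : ℝ) / (4 * n)⌉₊ + 1 ≤ minGap N r := by
  have h2n := two_mul_le_minGap hn hlam hlam'
  set δ := minGap N r with hδ
  have h3 : 3 ≤ δ := by
    have : ((3 : ℕ) : ℝ) ≤ δ := by push_cast; linarith
    exact_mod_cast this
  have h3' : (3 : ℝ) ≤ δ := by exact_mod_cast h3
  have : ⌈3 * (δ : ℝ) / (4 * n)⌉₊ ≤ δ - 1 := by
    refine Nat.ceil_le.2 ?_
    rw [Nat.cast_sub (by omega), div_le_iff₀ (by linarith)]
    push_cast
    nlinarith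
  omega

theorem cast_gap (h : IsContPiecewiseLinear T f N r) {j : ℕ} (hj : j ≤ N) :
    (gap r j : ℝ) = r (j + 1) - r j := by
  rw [gap, Nat.cast_sub (h.r_lt j hj).le]

/-- Each admissible range stays 3δ/(4n) away from the midpoints bounding it, and by monotonicity
from all others; doubling clears the halves. -/
theorem farFromMidpoints_of_admissible (h : IsContPiecewiseLinear T f N r)
    (hn : 3 / 2 ≤ n) {d : ℕ} (hd : (d : ℝ) ∈ admissible n T N r) :
    FarFromMidpoints N r ⌈3 * (minGap N r : ℝ) / (2 * n)⌉₊ d := by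
  intro i hi1 hiN
  have hmono : ∀ {a b : ℕ}, a ≤ b → b ≤ N + 1 → (r a : ℝ) ≤ r b := fun hab hb => by
    exact_mod_cast h.mono hab hb
  set δ : ℝ := (minGap N r : ℝ)
  have e : 3 * δ / (2 * n) = 2 * (3 * δ / (4 * n)) := by
    have : 0 < n := by linarith
    field_simp
    norm_num
  have key : 2 * (d : ℝ) + 3 * δ / (2 * n) ≤ r i + r (i + 1) ∨
      (r i : ℝ) + r (i + 1) + 3 * δ / (2 * n) ≤ 2 * d := by
    rw [e]
    rcases hd with (hd | hd) | hd
    · left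
      have h1 := hd.2
      rw [cast_gap h (by omega)] at h1
      have h2 := hmono hi1 (by omega)
      have h3 := hmono (show 1 + 1 ≤ i + 1 by omega) (by omega)
      linarith
    · right
      have h1 := hd.1
      rw [cast_gap h (by omega), Nat.sub_add_cancel (by omega)] at h1
      have h2 := hmono (show i ≤ N - 1 by omega) (by omega)
      have h3 := hmono hiN (by omega)
      linarith
    · simp only [Set.mem_iUnion] at hd
      obtain ⟨j, hj, hd⟩ := hd
      rw [Set.mem_Icc] at hj
      rcases le_or_gt j i with hji | hij
      · left
        have h1 := hd.2
        rw [cast_gap h (j := j) (by omega)] at h1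
        have h2 := hmono hji (by omega)
        have h3 := hmono (show j + 1 ≤ i + 1 by omega) (by omega)
        linarith
      · right
        have h1 := hd.1
        rw [cast_gap h (j := j - 1) (by omega), Nat.sub_add_cancel (by omega)] at h1
        have h2 := hmono (show i ≤ j - 1 by omega) (by omega)
        have h3 := hmono (show i + 1 ≤ j by omega) (by omega)
        linarith
  refine key.imp (fun hk => ?_) fun hk => ?_
  · have h0 : 2 * d ≤ r i + r (i + 1) := by
      have : 0 ≤ 3 * δ / (2 * n) := by positivity
      have : ((2 * d : ℕ) : ℝ) ≤ (r i + r (i + 1) : ℕ) := by push_cast; linarith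
      exact_mod_cast this
    have : ⌈3 * δ / (2 * n)⌉₊ ≤ r i + r (i + 1) - 2 * d :=
      Nat.ceil_le.2 (by rw [Nat.cast_sub h0]; push_cast; linarith)
    omega
  · have h0 : r i + r (i + 1) ≤ 2 * d := by
      have : 0 ≤ 3 * δ / (2 * n) := by positivity
      have : ((r i + r (i + 1) : ℕ) : ℝ) ≤ (2 * d : ℕ) := by push_cast; linarith
      exact_mod_cast this
    have : ⌈3 * δ / (2 * n)⌉₊ ≤ 2 * d - (r i + r (i + 1)) :=
      Nat.ceil_le.2 (by rw [Nat.cast_sub h0]; push_cast; linarith)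
    omega

theorem lt_mul_jump_of_lt_mul_minJump {c A : ℝ} (hA : 0 ≤ A)
    (h : ENNReal.ofReal c < ENNReal.ofReal A * minJump f N r) {j : ℕ}
    (hj : j ∈ Finset.Icc 1 N) : c < A * jump f r j := by
  have h1 : minJump f N r ≤ ENNReal.ofReal (jump f r j) := iInf₂_le j hj
  have h2 : ENNReal.ofReal c < ENNReal.ofReal (A * jump f r j) := by
    rw [ENNReal.ofReal_mul hA]
    exact h.trans_le (by gcongr)
  exact (ENNReal.ofReal_lt_ofReal_iff'.1 h2).1

/-- Take cube roots, using 16³ = 4096 ≥ 3456. -/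
theorem mul_rpow_two_thirds_le {x y l : ℝ} (hy : 0 ≤ y) (hl : 0 ≤ l)
    (h : y ^ 2 * x ^ 3 ≤ 3456 * l) :
    x * y ^ ((2 : ℝ) / 3) ≤ 16 * l ^ ((1 : ℝ) / 3) := by
  refine le_of_pow_le_pow_left₀ three_ne_zero (by positivity) ?_
  have h1 : (y ^ ((2 : ℝ) / 3)) ^ 3 = y ^ 2 := by
    rw [← Real.rpow_natCast, ← Real.rpow_mul hy, ← Real.rpow_natCast]
    norm_num
  have h2 : (l ^ ((1 : ℝ) / 3)) ^ 3 = l := by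
    rw [← Real.rpow_natCast, ← Real.rpow_mul hl]
    norm_num
  rw [mul_pow, mul_pow, h1, h2]
  linarith

theorem consistent_of_noiseBound {z : ℕ → ℝ} (h : IsContPiecewiseLinear T f N r) (hT : 2 ≤ T)
    (hn : 3 / 2 ≤ n) (hlam : 1 ≤ lam) (hlam' : (lam : ℝ) ≤ (minGap N r : ℝ) / (2 * n))
    (hzeta : 64 * √(Real.log T) ≤ zeta)
    (hsmall : ENNReal.ofReal zeta < ENNReal.ofReal
      (1 / (80 * n ^ 2) * (minGap N r : ℝ) ^ ((3 : ℝ) / 2)) * minJump f N r)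
    (hz : NoiseBound f z T √(Real.log T))
    (hadm : LargestDiffAdmissible n T N r (fun t => f t + z t) lam zeta) :
    Consistent 16 T f N r (fun t => f t + z t) lam zeta := by
  have hT' : (2 : ℝ) ≤ T := by exact_mod_cast hT
  have hlog : 0 < Real.log T := Real.log_pos (by linarith)
  have hL : 0 < √(Real.log T) := Real.sqrt_pos.2 hlog
  have hM := margins (f := f) hn hlam hlam' (by linarith) fun j hj =>
    lt_mul_jump_of_lt_mul_minJump (by positivity) hsmall hj
  have hest := estimates_of_noiseBound h hz hL hzeta hM
    (margin_add_one_le_minGap hn hlam hlam') fun s e hv hse hex =>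
      farFromMidpoints_of_admissible h hn (hadm s e hv hse hex)
  rw [Real.sq_sqrt hlog.le] at hest
  exact ⟨hest.1, fun j hj => mul_rpow_two_thirds_le (abs_nonneg _) hlog.le
    (hest.2 j hj)⟩

end Constants

/-! ### The noise -/

theorem hasSubgaussianMGF_of_hasLaw_gaussianReal {Ω : Type*} [MeasurableSpace Ω] {P : Measure Ω}
    {X : Ω → ℝ} {v : NNReal} (h : HasLaw X (gaussianReal 0 v) P) : HasSubgaussianMGF X v P where
  integrable_exp_mul t := by
    have hi := integrable_exp_mul_gaussianReal (μ := 0) (v := v) t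
    rw [← h.map_eq] at hi
    exact hi.comp_aemeasurable h.aemeasurable
  mgf_le t := by
    rw [mgf_gaussianReal h.map_eq, zero_mul, zero_add]

section Noise

variable {Ω : Type*} [MeasurableSpace Ω] {P : Measure Ω} {ε : ℕ → Ω → ℝ} {T : ℕ}

theorem hasSubgaussianMGF_sum (hlaw : ∀ t ∈ Set.Icc 1 T, HasLaw (ε t) (gaussianReal 0 1) P)
    (hind : iIndepFun (fun t : Set.Icc 1 T => ε t) P) {s e : ℕ} (hs : 1 ≤ s) (he : e ≤ T)
    (v : ℕ → ℝ) :
    HasSubgaussianMGF (fun ω => ∑ t ∈ Finset.Icc s e, ε t ω * v t)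
      (∑ t ∈ Finset.Icc s e, (v t ^ 2).toNNReal) P := by
  have hmem : ∀ t ∈ Finset.Icc s e, t ∈ Set.Icc 1 T := fun t ht => by
    rw [Finset.mem_Icc] at ht
    exact ⟨by omega, by omega⟩
  have hind' : iIndepFun (fun (t : Set.Icc 1 T) ω => v t * ε t ω) P :=
    hind.comp (fun t y => v t * y) fun t => measurable_const_mul _
  have hterm : ∀ t : Set.Icc 1 T,
      HasSubgaussianMGF (fun ω => v t * ε t ω) (v t ^ 2).toNNReal P := fun t => by
    convert (hasSubgaussianMGF_of_hasLaw_gaussianReal (hlaw t t.2)).const_mul (v t) using 1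
    exact (Real.toNNReal_of_nonneg (sq_nonneg _)).trans (mul_one (_ : NNReal)).symm
  classical
  have key := HasSubgaussianMGF.sum_of_iIndepFun hind'
    (s := (Finset.Icc s e).subtype (· ∈ Set.Icc 1 T)) fun t _ => hterm t
  rw [Finset.sum_subtype_of_mem (fun t => (v t ^ 2).toNNReal) hmem] at key
  refine key.congr (ae_of_all _ fun ω => ?_)
  simp only
  rw [Finset.sum_subtype_of_mem (fun t => v t * ε t ω) hmem]
  exact Finset.sum_congr rfl fun t _ => mul_comm _ _

/-- The sub-Gaussian tail at 4L standard deviations, applied to both signs. -/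
theorem measureReal_lt_abs_sum_le [IsProbabilityMeasure P]
    (hlaw : ∀ t ∈ Set.Icc 1 T, HasLaw (ε t) (gaussianReal 0 1) P)
    (hind : iIndepFun (fun t : Set.Icc 1 T => ε t) P) {s e : ℕ} (hs : 1 ≤ s) (he : e ≤ T)
    (v : ℕ → ℝ) {L : ℝ} (hL : 0 ≤ L) :
    P.real {ω | 4 * L * √(∑ t ∈ Finset.Icc s e, v t ^ 2) <
      |∑ t ∈ Finset.Icc s e, ε t ω * v t|} ≤ 2 * Real.exp (-8 * L ^ 2) := by
  have h := hasSubgaussianMGF_sum hlaw hind hs he v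
  set V : ℝ := ∑ t ∈ Finset.Icc s e, v t ^ 2 with hV
  have hV0 : 0 ≤ V := Finset.sum_nonneg fun _ _ => sq_nonneg _
  have hc : ((∑ t ∈ Finset.Icc s e, (v t ^ 2).toNNReal : NNReal) : ℝ) = V := by
    rw [NNReal.coe_sum]
    exact Finset.sum_congr rfl fun t _ => Real.coe_toNNReal _ (sq_nonneg _)
  rcases hV0.eq_or_lt with hV0 | hV0
  -- For zero variance the tail formula divides by zero, but the strict inequality makes the event
  -- empty.
  · have hv : ∀ t ∈ Finset.Icc s e, v t = 0 := fun t ht => by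
      have := (Finset.sum_eq_zero_iff_of_nonneg fun _ _ => sq_nonneg _).1 hV0.symm t ht
      exact pow_eq_zero_iff two_ne_zero |>.1 this
    have hempty : {ω | 4 * L * √V < |∑ t ∈ Finset.Icc s e, ε t ω * v t|} = ∅ := by
      refine Set.eq_empty_of_forall_notMem fun ω hω => ?_
      rw [Set.mem_ofPred_eq, ← hV0, Finset.sum_eq_zero fun t ht => by rw [hv t ht, mul_zero]] at hω
      simp at hω
    rw [hempty, measureReal_empty]
    positivity
  · have hx : 0 ≤ 4 * L * √V := by positivity
    have hexp : -(4 * L * √V) ^ 2 / (2 * V) = -8 * L ^ 2 := by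
      rw [mul_pow, Real.sq_sqrt hV0.le]
      field_simp
      ring
    have h1 := h.measure_ge_le hx
    have h2 := h.neg.measure_ge_le hx
    rw [hc, hexp] at h1 h2
    calc P.real {ω | 4 * L * √V < |∑ t ∈ Finset.Icc s e, ε t ω * v t|}
        ≤ P.real ({ω | 4 * L * √V ≤ ∑ t ∈ Finset.Icc s e, ε t ω * v t} ∪
            {ω | 4 * L * √V ≤ (-fun ω => ∑ t ∈ Finset.Icc s e, ε t ω * v t) ω}) := by
          refine measureReal_mono fun ω hω => ?_
          rcases lt_abs.1 (Set.mem_ofPred.1 hω) with hω | hω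
          · exact Or.inl hω.le
          · exact Or.inr hω.le
      _ ≤ _ := (measureReal_union_le _ _).trans (by linarith)

/-- All directions are deterministic and indexed by at most T⁴ quadruples (s, r, b, e). With L² =
log T each carries probability at most 4T⁻⁸, so the union bound gives 4T⁻⁴. -/
theorem exists_noiseBound_event [IsProbabilityMeasure P]
    (hlaw : ∀ t ∈ Set.Icc 1 T, HasLaw (ε t) (gaussianReal 0 1) P)
    (hind : iIndepFun (fun t : Set.Icc 1 T => ε t) P) (hT : 1 ≤ T) (f : ℕ → ℝ) :
    ∃ E : Set Ω, P.real E ≤ 4 / T ∧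
      ∀ ω ∉ E, NoiseBound f (fun t => ε t ω) T √(Real.log T) := by
  have hT' : (1 : ℝ) ≤ T := by exact_mod_cast hT
  have hT0 : (0 : ℝ) < T := by linarith
  set L := √(Real.log T) with hL
  have hL0 : 0 ≤ L := Real.sqrt_nonneg _
  have hL2 : L ^ 2 = Real.log T := Real.sq_sqrt (Real.log_nonneg hT')
  have hexp : Real.exp (-8 * L ^ 2) = 1 / (T : ℝ) ^ 8 := by
    rw [hL2, neg_mul, Real.exp_neg, one_div]
    congr 1
    have := Real.exp_nat_mul (Real.log T) 8
    rw [Real.exp_log hT0] at this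
    exact_mod_cast this
  set w : ℕ → ℕ → ℕ → ℕ → ℕ → ℝ := fun s r b e t =>
    score f s e r * phi s e r t - score f s e b * phi s e b t with hw
  set bad : ℕ × ℕ × ℕ × ℕ → Set Ω := fun q =>
    {ω | 4 * L * √(∑ t ∈ Finset.Icc q.1 q.2.2.2, phi q.1 q.2.2.2 q.2.2.1 t ^ 2) <
      |∑ t ∈ Finset.Icc q.1 q.2.2.2, ε t ω * phi q.1 q.2.2.2 q.2.2.1 t|} ∪
    {ω | 4 * L * √(∑ t ∈ Finset.Icc q.1 q.2.2.2, w q.1 q.2.1 q.2.2.1 q.2.2.2 t ^ 2) <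
      |∑ t ∈ Finset.Icc q.1 q.2.2.2, ε t ω * w q.1 q.2.1 q.2.2.1 q.2.2.2 t|} with hbad
  set K := Finset.Icc 1 T ×ˢ Finset.Icc 1 T ×ˢ Finset.Icc 1 T ×ˢ Finset.Icc 1 T with hK
  have hnot : ∀ ω, ω ∉ ⋃ q ∈ K, bad q → ∀ s r b e : ℕ, 1 ≤ s → s ≤ r → r < e → s ≤ b → b < e →
      e ≤ T → ω ∉ bad (s, r, b, e) := by
    intro ω hω s r b e h1 h2 h3 h4 h5 h6 hmem
    refine hω (Set.mem_biUnion (x := (s, r, b, e)) ?_ hmem)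
    simp only [hK, Finset.coe_product, Set.mem_prod, Finset.coe_Icc, Set.mem_Icc]
    omega
  refine ⟨⋃ q ∈ K, bad q, ?_, fun ω hω => ⟨?_, ?_⟩⟩
  · calc P.real (⋃ q ∈ K, bad q) ≤ ∑ q ∈ K, P.real (bad q) := measureReal_biUnion_finset_le _ _
      _ ≤ ∑ q ∈ K, 4 * (1 / (T : ℝ) ^ 8) := by
          refine Finset.sum_le_sum fun q hq => ?_
          simp only [hK, Finset.mem_product, Finset.mem_Icc] at hq
          refine (measureReal_union_le _ _).trans ?_
          have h1 := measureReal_lt_abs_sum_le hlaw hind hq.1.1 hq.2.2.2.2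
            (phi q.1 q.2.2.2 q.2.2.1) hL0
          have h2 := measureReal_lt_abs_sum_le hlaw hind hq.1.1 hq.2.2.2.2
            (w q.1 q.2.1 q.2.2.1 q.2.2.2) hL0
          rw [hexp] at h1 h2
          linarith
      _ = 4 / (T : ℝ) ^ 4 := by
          rw [Finset.sum_const, hK]
          simp only [Finset.card_product, Nat.card_Icc, Nat.add_sub_cancel, nsmul_eq_mul]
          push_cast
          field_simp
      _ ≤ 4 / T := by
          gcongr
          exact le_self_pow₀ hT' (by norm_num)
  · intro s b e h1 h2 h3 h4
    have := hnot ω hω s b b e h1 h2 h3 h2 h3 h4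
    simp only [hbad, Set.mem_union, Set.mem_ofPred_eq, not_or, not_lt] at this
    refine this.1.trans ?_
    have hle : √(∑ t ∈ Finset.Icc s e, phi s e b t ^ 2) ≤ 1 :=
      Real.sqrt_le_one.2 (sum_phi_sq_le h2 h3)
    nlinarith
  · intro s r b e h1 h2 h3 h4 h5 h6
    have := hnot ω hω s r b e h1 h2 h3 h4 h5 h6
    simp only [hbad, Set.mem_union, Set.mem_ofPred_eq, not_or, not_lt] at this
    exact this.2

end Noise

end DAIS

end

/-! ### Choice of constants and conclusion -/

theorem theorem2 (n : ℝ) (hn : 3 / 2 ≤ n) :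
    ∃ Cmin : ℝ, 0 < Cmin ∧ ∀ Cstar : ℝ, Cmin ≤ Cstar →
    ∃ C₁ C₂ C₃ C₄ : ℝ, 0 < C₁ ∧ 0 < C₂ ∧ 0 < C₃ ∧ 0 < C₄ ∧ ∃ T₀ : ℕ, ∀ T : ℕ, T₀ ≤ T →
    -- the signal, with change-points `r 1 < ⋯ < r N`
    ∀ (f : ℕ → ℝ) (N : ℕ) (r : ℕ → ℕ), DAIS.IsContPiecewiseLinear T f N r →
    ENNReal.ofReal (Cstar * √(Real.log T)) ≤
      ENNReal.ofReal ((DAIS.minGap N r : ℝ) ^ ((3 : ℝ) / 2)) * DAIS.minJump f N r →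
    -- the expansion parameter and the threshold
    ∀ (lam : ℕ) (zeta : ℝ), 1 ≤ lam → (lam : ℝ) ≤ (DAIS.minGap N r : ℝ) / (2 * n) →
    C₁ * √(Real.log T) ≤ zeta →
    ENNReal.ofReal zeta <
      ENNReal.ofReal (C₂ * (DAIS.minGap N r : ℝ) ^ ((3 : ℝ) / 2)) * DAIS.minJump f N r →
    -- the noise
    ∀ (Ω : Type*) [MeasurableSpace Ω] (P : Measure Ω) [IsProbabilityMeasure P] (ε : ℕ → Ω → ℝ),
    (∀ t ∈ Set.Icc 1 T, HasLaw (ε t) (gaussianReal 0 1) P) →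
    iIndepFun (fun t : Set.Icc 1 T => ε t) P →
    1 - C₄ / T ≤ P.real {ω |
      DAIS.LargestDiffAdmissible n T N r (fun t => f t + ε t ω) lam zeta →
        DAIS.Consistent C₃ T f N r (fun t => f t + ε t ω) lam zeta} := by
  have hn0 : 0 < n := by linarith
  -- The lower bound on `Cstar` gives C₂ · Cstar > C₁, so (A3) leaves a nonempty range of
  -- thresholds. T₀ = 2 ensures log T > 0.
  refine ⟨64 * (80 * n ^ 2) + 1, by positivity, fun Cstar _ => ⟨64, 1 / (80 * n ^ 2), 16, 4,
    by norm_num, by positivity, by norm_num, by norm_num, 2, ?_⟩⟩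
  intro T hT f N r hf _ lam zeta hlam hlam' hzeta hsmall Ω _ P _ ε hlaw hind
  obtain ⟨E, hE, hgood⟩ := DAIS.exists_noiseBound_event hlaw hind (by omega) f
  set S := {ω | DAIS.LargestDiffAdmissible n T N r (fun t => f t + ε t ω) lam zeta →
    DAIS.Consistent 16 T f N r (fun t => f t + ε t ω) lam zeta} with hS
  -- Covering the whole space and using subadditivity avoids any measurability of the event S.
  have hcover : Set.univ ⊆ S ∪ E := by
    intro ω _
    by_cases hω : ω ∈ E
    · exact Or.inr hω
    · exact Or.inl fun hadm => DAIS.consistent_of_noiseBound hf hT hn hlam hlam' hzeta hsmall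
        (hgood ω hω) hadm
  have h1 : P.real Set.univ ≤ P.real (S ∪ E) := measureReal_mono hcover
  rw [probReal_univ] at h1
  have h2 := measureReal_union_le (μ := P) S E
  linarith
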